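/- Let $d\ge 0$, $q\ge 1$ be integers, let $\phi=(\phi_1,\dots,\phi_q):[0,1]^d\to\mathbb{R}^q$ be bounded and Borel measurable with first coordinate $\phi_1\equiv 1$ (property (P1)), and let $\alpha\in\mathbb{R}^q$. Let $\mathcal{C}_d$ be the set of copula distributions with pdf, i.e. probability distributions $P$ on $[0,1]^d$ that have a density $p$ with respect to Lebesgue measure and whose one-dimensional marginals are all uniform on $[0,1]$. Let $h(P)=-\int_{[0,1]^d}p\log p\,du\in[-\infty,0]$ be the differential entropy of $P\in\mathcal{C}_d$. Call $P\in\mathcal{C}_d$ \emph{feasible} if $E_P[\phi(u)]=\alpha$, and consider the problem $$\max_{P\in\mathcal{C}_d}\ h(P)\quad\text{subject to}\quad E_P[\phi(u)]=\alpha.\tag{MIND}$$ Assume that there is a feasible $P$ with finite differential entropy. Then: 1. (MIND) has exactly one solution $P_{\mathrm M}$. 2. Every feasible copula distribution whose density has the form $$e^{\theta^{T}\phi(u)}\prod_{i=1}^d f_i(u_i)\tag{$*$}$$ for some $\theta\in\mathbb{R}^q$ and some non-negative functions $f_1,\dots,f_d$ on $[0,1]$ with $\log f_i\in L^1([0,1])$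 (so that $f_i>0$ almost everywhere) is equal to $P_{\mathrm M}$. 3. If, moreover, some feasible $P$ with finite differential entropy has a density that is positive almost everywhere on $[0,1]^d$, then the density of $P_{\mathrm M}$ has the form $(*)$, so that $P_{\mathrm M}$ is the only feasible copula distribution with a density of that form; and for every feasible $P$ (with finite entropy or not) $$h(P_{\mathrm M})-h(P)=KL(P\,\|\,P_{\mathrm M})\in[0,\infty].$$ -/

import Mathlib

open MeasureTheory InformationTheory
open scoped unitInterval

/-- The unit cube `[0,1]^d`; its `volume` is the uniform distribution on the cube. -/
abbrev Cube (d : ℕ) : Type := Fin d → I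

/-- The space `𝒞_d` of copula distributions with a pdf: probability measures on `[0,1]^d`
with a density with respect to Lebesgue measure and with uniform one-dimensional marginals. -/
def copulasWithPdf (d : ℕ) : Set (Measure (Cube d)) :=
  {P | IsProbabilityMeasure P ∧ P ≪ volume ∧
    ∀ i : Fin d, P.map (fun u : Cube d => u i) = (volume : Measure I)}

/-- The pdf of `P` (a measure on the cube that is absolutely continuous). -/
noncomputable def pdfOf {d : ℕ} (P : Measure (Cube d)) (u : Cube d) : ℝ :=
  (P.rnDeriv volume u).toReal

/-- Differential entropy `h(P) = -∫ p log p` of a distribution on the cube with pdf `p`, as the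
difference of the integrals of the positive and the negative part of `-p log p`. As `-p log p ≤ 1`,
the first integral is finite, so that `h(P)` is well defined in `[-∞, ∞)`. -/
noncomputable def diffEntropy {d : ℕ} (P : Measure (Cube d)) : EReal :=
  ((∫⁻ u : Cube d, ENNReal.ofReal (Real.negMulLog (pdfOf P u)) : ENNReal) : EReal) -
    ((∫⁻ u : Cube d, ENNReal.ofReal (-Real.negMulLog (pdfOf P u)) : ENNReal) : EReal)

/-- `P` has finite differential entropy. -/
def HasFiniteEntropy {d : ℕ} (P : Measure (Cube d)) : Prop :=
  diffEntropy P ≠ ⊥ ∧ diffEntropy P ≠ ⊤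

/-- The feasible set of the problem: copula distributions with pdf such that `E_P[φ] = α`. -/
def feasibleCopulas {d q : ℕ} (φ : Cube d → Fin q → ℝ) (α : Fin q → ℝ) :
    Set (Measure (Cube d)) :=
  {P | P ∈ copulasWithPdf d ∧
    ∀ j : Fin q, Integrable (fun u => φ u j) P ∧ ∫ u, φ u j ∂P = α j}

/-- `P` solves the maximum-entropy copula problem: maximize `h(P)` over the feasible set. -/
def IsMaxEntropyCopula {d q : ℕ} (φ : Cube d → Fin q → ℝ) (α : Fin q → ℝ)
    (P : Measure (Cube d)) : Prop :=
  P ∈ feasibleCopulas φ α ∧ IsMaxOn diffEntropy (feasibleCopulas φ α) P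

/-- `P` has a density of the form `exp (θᵀ φ(u)) ∏ᵢ fᵢ(uᵢ)` for some vector `θ` and non-negative
functions `fᵢ` with `log fᵢ ∈ L¹([0,1])`. Since `Real.log 0 = 0` in Lean, the requirement
`log fᵢ > -∞` almost everywhere, part of `log fᵢ ∈ L¹`, is written out. -/
def HasExponentialForm {d q : ℕ} (φ : Cube d → Fin q → ℝ) (P : Measure (Cube d)) : Prop :=
  ∃ (θ : Fin q → ℝ) (f : Fin d → I → ℝ),
    (∀ i t, 0 ≤ f i t) ∧
    (∀ i, ∀ᵐ t : I, 0 < f i t) ∧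
    (∀ i, Integrable (fun t : I => Real.log (f i t))) ∧
    P = volume.withDensity
      (fun u : Cube d => ENNReal.ofReal (Real.exp (∑ j, θ j * φ u j) * ∏ i, f i (u i)))

/-! ### Entropy minimization under bounded linear constraints -/

section Abstract

open Filter Topology

/-! For a density `p` on the cube, `-h(P) = ∫ klFun p`, so the task is to minimize a strictly convex
nonnegative functional under linear constraints with bounded test functions: indicators of one
coordinate, and the `φ j`. The midpoint gap of `klFun` controls the `L¹` distance
(`integral_abs_sub_le_of_entropy_le`). Hence a minimizing sequence is Cauchy in `L¹`, its limit
keeps the constraints, Fatou bounds its entropy, and the minimizer is unique. Since `x log x` has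
slope `-∞` at `0`, the minimizer is positive a.e. as soon as some competitor of finite entropy is.

The exponential form comes from bounded variations. Let `T F (x, a) = F x + (d - 1) F a - ∑ᵢ F (a
with xᵢ in place i)` (`interaction`); it kills constants and functions of one coordinate. On the
pairs whose mixed points all satisfy `ε ≤ p ≤ ε⁻¹`, let `w` be the `L²` residual of `T (log p)`
after projection onto the span of the `T (φ j)`. Then `T* w` is a bounded variation that respects
every constraint, so it is orthogonal to `log p`; this says `∫ w² = 0`. Linear algebra removes the
dependence of the coefficients on `ε`. With a generic base point `a` fixed, `log p - ∑ θ j φ j` is a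
constant plus functions of one coordinate, and `φ 0 = 1` absorbs the constant. Uniform marginals
then bound the logarithms of the factors.

Conversely, the logarithm of a density of exponential form has the same integral under all feasible
copulas. This yields the Pythagorean identity `diffEntropy_sub_eq_klDiv`, and with it the optimality
of every feasible copula of that form. -/

/-- Twice the gap in the midpoint convexity inequality of `klFun` is at least the squared
Hellinger distance of its arguments. -/
lemma sq_sqrt_sub_sqrt_le_klFun_gap {a b : ℝ} (ha : 0 ≤ a) (hb : 0 ≤ b) :
    (√a - √b) ^ 2 ≤ 2 * (klFun a + klFun b - 2 * klFun ((a + b) / 2)) := by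
  rcases (add_nonneg ha hb).eq_or_lt with h0 | hpos
  · obtain rfl : a = 0 := by linarith
    obtain rfl : b = 0 := by linarith
    simp [two_mul]
  set m := (a + b) / 2 with hm
  have hmpos : 0 < m := by positivity
  -- This is `log y ≤ y - 1` at `y = √m / √x`. Adding the cases `x = a` and `x = b` bounds the gap
  -- below by `2√m (2√m - (√a + √b))`.
  have key : ∀ x : ℝ, 0 ≤ x → 2 * (x - √m * √x) ≤ x * Real.log x - x * Real.log m := by
    intro x hx
    rcases hx.eq_or_lt with rfl | hx'
    · simp
    have hsx : 0 < √x := Real.sqrt_pos.2 hx'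
    have hsm : 0 < √m := Real.sqrt_pos.2 hmpos
    have h1 : Real.log (√m / √x) ≤ √m / √x - 1 := Real.log_le_sub_one_of_pos (by positivity)
    rw [Real.log_div hsm.ne' hsx.ne', Real.log_sqrt hmpos.le, Real.log_sqrt hx] at h1
    have h2 : x * (√m / √x) = √m * √x := by
      field_simp
      rw [Real.sq_sqrt hx]
    nlinarith [mul_le_mul_of_nonneg_left h1 hx]
  have h1 := key a ha
  have h2 := key b hb
  have hgap : klFun a + klFun b - 2 * klFun m
      = a * Real.log a - a * Real.log m + (b * Real.log b - b * Real.log m) := by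
    simp only [klFun_apply, hm]; ring
  have hsa := Real.sq_sqrt ha
  have hsb := Real.sq_sqrt hb
  have hsm := Real.sq_sqrt hmpos.le
  have hA := Real.sqrt_nonneg a
  have hB := Real.sqrt_nonneg b
  have hM := Real.sqrt_pos.2 hmpos
  have hmab : 2 * √m ^ 2 = √a ^ 2 + √b ^ 2 := by rw [hsa, hsb, hsm, hm]; ring
  rw [hgap]
  have hS : √a + √b ≤ 2 * √m := by
    apply abs_le_of_sq_le_sq' _ (by positivity) |>.2
    nlinarith [sq_nonneg (√a - √b)]
  -- With `S = √a + √b ≤ 2√m`, the left side equals `(2√m - S)(2√m + S)`.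
  have h3 : (√a - √b) ^ 2 ≤ 4 * √m * (2 * √m - (√a + √b)) := by
    nlinarith [mul_nonneg (sub_nonneg.2 hS) (sub_nonneg.2 hS)]
  nlinarith

/-- Factor `|a - b| = |√a - √b| (√a + √b)` and apply Young's inequality with weight `s`, so that the
estimate integrates without Cauchy–Schwarz. The weight is tuned later to the entropy excess. -/
lemma abs_sub_le_klFun_gap {a b s : ℝ} (ha : 0 ≤ a) (hb : 0 ≤ b) (hs : 0 < s) :
    |a - b| ≤ s * (a + b) + (klFun a + klFun b - 2 * klFun ((a + b) / 2)) / s := by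
  have h := sq_sqrt_sub_sqrt_le_klFun_gap ha hb
  set D := klFun a + klFun b - 2 * klFun ((a + b) / 2)
  have hsa := Real.sq_sqrt ha
  have hsb := Real.sq_sqrt hb
  have hA := Real.sqrt_nonneg a
  have hB := Real.sqrt_nonneg b
  have h1 : |a - b| = |√a - √b| * (√a + √b) := by
    rw [← abs_of_nonneg (add_nonneg hA hB), ← abs_mul]
    congr 1
    nlinarith
  rw [h1, ← sub_nonneg]
  have h2 : 0 ≤ (s * (√a + √b) - |√a - √b|) ^ 2 := sq_nonneg _
  have h3 : (√a + √b) ^ 2 ≤ 2 * (a + b) := by nlinarith [sq_nonneg (√a - √b)]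
  have h4 : |√a - √b| ^ 2 ≤ 2 * D := by rwa [sq_abs]
  have : s * (a + b) + D / s - |√a - √b| * (√a + √b)
      = (s ^ 2 * (a + b) + D - s * (|√a - √b| * (√a + √b))) / s := by
    field_simp
  rw [this]
  apply div_nonneg _ hs.le
  nlinarith [mul_le_mul_of_nonneg_left h3 (sq_nonneg s)]

variable {Ω K : Type*} [MeasurableSpace Ω] {μ : Measure Ω}
  {ψ : K → Ω → ℝ} {c : K → ℝ} {p p' : Ω → ℝ}

/-- `p` is a probability density with prescribed integrals `c k` of the functions `ψ k`. -/
structure IsConstrainedDensity (μ : Measure Ω) (ψ : K → Ω → ℝ) (c : K → ℝ) (p : Ω → ℝ) :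
    Prop where
  measurable : Measurable p
  nonneg : ∀ x, 0 ≤ p x
  integrable : Integrable p μ
  integral_eq_one : ∫ x, p x ∂μ = 1
  integral_mul : ∀ k, ∫ x, ψ k x * p x ∂μ = c k

/-- The test functions are measurable and bounded. -/
structure BoundedTests (ψ : K → Ω → ℝ) : Prop where
  measurable : ∀ k, Measurable (ψ k)
  bounded : ∀ k, ∃ C, ∀ x, |ψ k x| ≤ C

/-- `p` minimizes the relative entropy `∫ klFun p` among constrained densities. -/
structure IsEntropyMinimizer (μ : Measure Ω) (ψ : K → Ω → ℝ) (c : K → ℝ) (p : Ω → ℝ) :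
    Prop where
  density : IsConstrainedDensity μ ψ c p
  integrable : Integrable (fun x => klFun (p x)) μ
  le : ∀ p', IsConstrainedDensity μ ψ c p' → Integrable (fun x => klFun (p' x)) μ →
    ∫ x, klFun (p x) ∂μ ≤ ∫ x, klFun (p' x) ∂μ

lemma BoundedTests.integrable_mul (hψ : BoundedTests ψ) (k : K) {f : Ω → ℝ}
    (hf : Integrable f μ) : Integrable (fun x => ψ k x * f x) μ := by
  obtain ⟨C, hC⟩ := hψ.bounded k
  exact hf.bdd_mul (hψ.measurable k).aestronglyMeasurable (Eventually.of_forall hC)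

lemma integrable_klFun_of_le {f g : Ω → ℝ} (hf : Measurable f) (hf0 : ∀ x, 0 ≤ f x)
    (hg : Integrable g μ) (h : ∀ᵐ x ∂μ, klFun (f x) ≤ g x) :
    Integrable (fun x => klFun (f x)) μ := by
  refine hg.mono' (measurable_klFun.comp hf).aestronglyMeasurable ?_
  filter_upwards [h] with x hx
  rwa [Real.norm_of_nonneg (klFun_nonneg (hf0 x))]

lemma IsConstrainedDensity.convexComb (hψ : BoundedTests ψ) (hp : IsConstrainedDensity μ ψ c p)
    (hp' : IsConstrainedDensity μ ψ c p') {s t : ℝ} (hs : 0 ≤ s) (ht : 0 ≤ t) (hst : s + t = 1) :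
    IsConstrainedDensity μ ψ c (fun x => s * p x + t * p' x) where
  measurable := (hp.measurable.const_mul s).add (hp'.measurable.const_mul t)
  nonneg x := add_nonneg (mul_nonneg hs (hp.nonneg x)) (mul_nonneg ht (hp'.nonneg x))
  integrable := (hp.integrable.const_mul s).add (hp'.integrable.const_mul t)
  integral_eq_one := by
    rw [integral_add (hp.integrable.const_mul s) (hp'.integrable.const_mul t),
      integral_const_mul, integral_const_mul, hp.integral_eq_one, hp'.integral_eq_one]
    linarith
  integral_mul k := by
    have : ∀ x, ψ k x * (s * p x + t * p' x) = s * (ψ k x * p x) + t * (ψ k x * p' x) :=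
      fun x => by ring
    simp_rw [this]
    rw [integral_add ((hψ.integrable_mul k hp.integrable).const_mul s)
      ((hψ.integrable_mul k hp'.integrable).const_mul t),
      integral_const_mul, integral_const_mul, hp.integral_mul, hp'.integral_mul, ← add_mul, hst,
      one_mul]

lemma klFun_convexComb_le {a b s t : ℝ} (ha : 0 ≤ a) (hb : 0 ≤ b) (hs : 0 ≤ s) (ht : 0 ≤ t)
    (hst : s + t = 1) : klFun (s * a + t * b) ≤ s * klFun a + t * klFun b := by
  simpa using convexOn_klFun.2 ha hb hs ht hst

lemma IsConstrainedDensity.integrable_klFun_convexComb (hp : IsConstrainedDensity μ ψ c p)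
    (hp' : IsConstrainedDensity μ ψ c p') (hF : Integrable (fun x => klFun (p x)) μ)
    (hF' : Integrable (fun x => klFun (p' x)) μ)
    {s t : ℝ} (hs : 0 ≤ s) (ht : 0 ≤ t) (hst : s + t = 1) :
    Integrable (fun x => klFun (s * p x + t * p' x)) μ :=
  integrable_klFun_of_le ((hp.measurable.const_mul s).add (hp'.measurable.const_mul t))
    (fun x => add_nonneg (mul_nonneg hs (hp.nonneg x)) (mul_nonneg ht (hp'.nonneg x)))
    ((hF.const_mul s).add (hF'.const_mul t))
    (Eventually.of_forall fun x => klFun_convexComb_le (hp.nonneg x) (hp'.nonneg x) hs ht hst)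

/-- Densities whose relative entropies are close to a lower bound are close in `L¹`. -/
lemma integral_abs_sub_le_of_entropy_le (hψ : BoundedTests ψ)
    (hp : IsConstrainedDensity μ ψ c p) (hp' : IsConstrainedDensity μ ψ c p')
    (hF : Integrable (fun x => klFun (p x)) μ) (hF' : Integrable (fun x => klFun (p' x)) μ)
    {m : ℝ} (hm : ∀ q, IsConstrainedDensity μ ψ c q → Integrable (fun x => klFun (q x)) μ →
      m ≤ ∫ x, klFun (q x) ∂μ) {s : ℝ} (hs : 0 < s) :
    ∫ x, |p x - p' x| ∂μ
      ≤ 2 * s + (∫ x, klFun (p x) ∂μ + ∫ x, klFun (p' x) ∂μ - 2 * m) / s := by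
  have hmid : ∀ x, (p x + p' x) / 2 = 1 / 2 * p x + 1 / 2 * p' x := fun x => by ring
  have hI := hp.integrable_klFun_convexComb hp' hF hF' (s := 1 / 2) (t := 1 / 2)
    (by norm_num) (by norm_num) (by norm_num)
  have hm' := hm _ (hp.convexComb hψ hp' (s := 1 / 2) (t := 1 / 2)
    (by norm_num) (by norm_num) (by norm_num)) hI
  simp_rw [← hmid] at hI hm'
  have hA : Integrable (fun x => klFun (p x) + klFun (p' x)) μ := hF.add hF'
  have hB : Integrable (fun x => klFun (p x) + klFun (p' x) - 2 * klFun ((p x + p' x) / 2)) μ :=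
    hA.sub (hI.const_mul 2)
  have hG := hB.div_const s
  have hS : Integrable (fun x => s * (p x + p' x)) μ :=
    (hp.integrable.add hp'.integrable).const_mul s
  calc ∫ x, |p x - p' x| ∂μ
      ≤ ∫ x, (s * (p x + p' x)
          + (klFun (p x) + klFun (p' x) - 2 * klFun ((p x + p' x) / 2)) / s) ∂μ :=
        integral_mono (hp.integrable.sub hp'.integrable).abs (hS.add hG)
          fun x => abs_sub_le_klFun_gap (hp.nonneg x) (hp'.nonneg x) hs
    _ = s * 2 + (∫ x, klFun (p x) ∂μ + ∫ x, klFun (p' x) ∂μ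
          - 2 * ∫ x, klFun ((p x + p' x) / 2) ∂μ) / s := by
        rw [integral_add hS hG, integral_const_mul, integral_add hp.integrable hp'.integrable,
          hp.integral_eq_one, hp'.integral_eq_one, integral_div,
          integral_sub hA (hI.const_mul 2), integral_add hF hF', integral_const_mul]
        norm_num
    _ ≤ _ := by
        rw [mul_comm s 2]
        gcongr

/-- The minimizer of the relative entropy is unique up to null sets. -/
lemma IsEntropyMinimizer.ae_eq (hψ : BoundedTests ψ) (hp : IsEntropyMinimizer μ ψ c p)
    (hp' : IsEntropyMinimizer μ ψ c p') : p =ᵐ[μ] p' := by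
  have heq : ∫ x, klFun (p x) ∂μ = ∫ x, klFun (p' x) ∂μ :=
    le_antisymm (hp.le _ hp'.density hp'.integrable) (hp'.le _ hp.density hp.integrable)
  have h0 : ∫ x, |p x - p' x| ∂μ ≤ 0 := by
    refine le_of_forall_pos_le_add fun ε hε => ?_
    -- Both entropies equal the lower bound, so the excess term vanishes and only `2 * (ε / 2)`
    -- remains.
    have := integral_abs_sub_le_of_entropy_le hψ hp.density hp'.density hp.integrable
      hp'.integrable hp.le (half_pos hε)
    rw [← heq] at this
    simp only [two_mul, sub_self, zero_div] at this
    linarith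
  have h1 : ∫ x, |p x - p' x| ∂μ = 0 := le_antisymm h0 (integral_nonneg fun x => abs_nonneg _)
  rw [integral_eq_zero_iff_of_nonneg (fun x => abs_nonneg _)
    (show Integrable (fun x => |p x - p' x|) μ from
      (hp.density.integrable.sub hp'.density.integrable).abs)] at h1
  filter_upwards [h1] with x hx
  exact sub_eq_zero.1 (abs_eq_zero.1 hx)

end Abstract

/-! ### Existence, positivity and the first-order condition for the entropy minimizer. -/

section Abstract

open Filter Topology

variable {Ω K : Type*} [MeasurableSpace Ω] {μ : Measure Ω}
  {ψ : K → Ω → ℝ} {c : K → ℝ} {p p' : Ω → ℝ}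

/-- Integrals against a bounded function pass to `L¹` limits. -/
lemma tendsto_integral_bdd_mul {f : ℕ → Ω → ℝ} {g w : Ω → ℝ} (hf : ∀ n, Integrable (f n) μ)
    (hg : Integrable g μ) (hw : Measurable w) {C : ℝ} (hC : ∀ x, |w x| ≤ C)
    (h : Tendsto (fun n => ∫ x, |f n x - g x| ∂μ) atTop (𝓝 0)) :
    Tendsto (fun n => ∫ x, w x * f n x ∂μ) atTop (𝓝 (∫ x, w x * g x ∂μ)) := by
  have hmul : ∀ {u : Ω → ℝ}, Integrable u μ → Integrable (fun x => w x * u x) μ := fun hu =>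
    hu.bdd_mul hw.aestronglyMeasurable (Eventually.of_forall hC)
  rw [tendsto_iff_dist_tendsto_zero]
  refine squeeze_zero (fun _ => dist_nonneg) (fun n => ?_) (by simpa using h.const_mul C)
  have hi : Integrable (fun x => |f n x - g x|) μ := ((hf n).sub hg).abs
  rw [Real.dist_eq, ← integral_sub (hmul (hf n)) (hmul hg), ← integral_const_mul]
  refine abs_integral_le_integral_abs.trans (integral_mono ?_ (hi.const_mul C) fun x => ?_)
  · exact ((hmul (hf n)).sub (hmul hg)).abs
  · simp only [← mul_sub, abs_mul]
    exact mul_le_mul_of_nonneg_right (hC x) (abs_nonneg _)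

/-- A feasible density of finite entropy implies the existence of an entropy minimizer. -/
theorem exists_isEntropyMinimizer (hψ : BoundedTests ψ)
    (hp : IsConstrainedDensity μ ψ c p) (hF : Integrable (fun x => klFun (p x)) μ) :
    ∃ q, IsEntropyMinimizer μ ψ c q := by
  set S : Set ℝ := {y | ∃ q, IsConstrainedDensity μ ψ c q ∧
    Integrable (fun x => klFun (q x)) μ ∧ ∫ x, klFun (q x) ∂μ = y} with hS
  have hbdd : BddBelow S := by
    refine ⟨0, ?_⟩
    rintro _ ⟨q, hq, -, rfl⟩
    exact integral_nonneg fun x => klFun_nonneg (hq.nonneg x)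
  obtain ⟨y, -, hy, hyS⟩ := exists_seq_tendsto_sInf (S := S) ⟨_, p, hp, hF, rfl⟩ hbdd
  choose f hfD hfI hfy using hyS
  set m := sInf S
  have hm : ∀ q, IsConstrainedDensity μ ψ c q → Integrable (fun x => klFun (q x)) μ →
      m ≤ ∫ x, klFun (q x) ∂μ := fun q hq hqI => csInf_le hbdd ⟨q, hq, hqI, rfl⟩
  let F : ℕ → Lp ℝ 1 μ := fun n => (hfD n).integrable.toL1 (f n)
  have hdist : ∀ i j, dist (F i) (F j) = ∫ x, |f i x - f j x| ∂μ := fun i j => by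
    rw [dist_eq_norm, ← Integrable.toL1_sub, L1.norm_of_fun_eq_integral_norm]
    rfl
  have hcauchy : CauchySeq F := by
    rw [Metric.cauchySeq_iff]
    intro ε hε
    -- With `s = ε / 8` and each excess below `ε * s / 8`, the `L¹` bound is at most `ε / 4 + ε / 4
    -- < ε`.
    have hs : 0 < ε / 8 := by positivity
    obtain ⟨N, hN⟩ := (hy.eventually (gt_mem_nhds (show m < m + ε * (ε / 8) / 8 by
      have : 0 < ε * (ε / 8) / 8 := by positivity
      linarith))).exists_forall_of_atTop
    refine ⟨N, fun i hi j hj => ?_⟩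
    rw [hdist]
    refine (integral_abs_sub_le_of_entropy_le hψ (hfD i) (hfD j) (hfI i) (hfI j) hm hs).trans_lt ?_
    rw [hfy, hfy]
    have h1 := hN i hi
    have h2 := hN j hj
    have h3 : (y i + y j - 2 * m) / (ε / 8) ≤ ε / 4 := by
      rw [div_le_iff₀ hs]
      linarith
    linarith
  obtain ⟨G, hG⟩ := cauchySeq_tendsto_of_complete hcauchy
  have hGm : Measurable G := (Lp.stronglyMeasurable G).measurable
  have hGi : Integrable G μ := L1.integrable_coeFn G
  -- Nonnegativity is required at every point; the positive part supplies it and does not increase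
  -- the distance to the nonnegative `f n`.
  set q : Ω → ℝ := fun x => max (G x) 0
  have hqm : Measurable q := hGm.max measurable_const
  have hqi : Integrable q μ := hGi.pos_part
  have hL1 : Tendsto (fun n => ∫ x, |f n x - q x| ∂μ) atTop (𝓝 0) := by
    rw [tendsto_iff_dist_tendsto_zero] at hG
    refine squeeze_zero (fun n => integral_nonneg fun x => abs_nonneg _) (fun n => ?_) hG
    have hd : dist (F n) G = ∫ x, |f n x - G x| ∂μ := by
      rw [dist_eq_norm, L1.norm_eq_integral_norm]
      refine integral_congr_ae ?_
      filter_upwards [Lp.coeFn_sub (F n) G, (hfD n).integrable.coeFn_toL1] with x h1 h2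
      rw [h1, Pi.sub_apply, h2, Real.norm_eq_abs]
    rw [hd]
    refine integral_mono ((hfD n).integrable.sub hqi).abs ((hfD n).integrable.sub hGi).abs
      fun x => ?_
    have := abs_max_sub_max_le_abs (f n x) (G x) 0
    rwa [max_eq_left ((hfD n).nonneg x)] at this
  have hqD : IsConstrainedDensity μ ψ c q := by
    refine ⟨hqm, fun x => le_max_right _ _, hqi, ?_, fun k => ?_⟩
    · have := tendsto_integral_bdd_mul (fun n => (hfD n).integrable) hqi
        (measurable_const (a := (1 : ℝ))) (C := 1) (by simp) hL1
      simp only [one_mul, (hfD _).integral_eq_one] at this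
      exact (tendsto_nhds_unique this tendsto_const_nhds)
    · obtain ⟨C, hC⟩ := hψ.bounded k
      have := tendsto_integral_bdd_mul (fun n => (hfD n).integrable) hqi (hψ.measurable k) hC hL1
      simp only [(hfD _).integral_mul] at this
      exact (tendsto_nhds_unique this tendsto_const_nhds)
  obtain ⟨ns, hns, hae⟩ := (tendstoInMeasure_of_tendsto_Lp hG).exists_seq_tendsto_ae
  have hconv : ∀ᵐ x ∂μ, Tendsto (fun i => f (ns i) x) atTop (𝓝 (q x)) := by
    have hall : ∀ᵐ x ∂μ, ∀ n, F n x = f n x :=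
      ae_all_iff.2 fun n => (hfD n).integrable.coeFn_toL1
    filter_upwards [hae, hall] with x hx hfx
    simp only [hfx] at hx
    have h0 : 0 ≤ G x := ge_of_tendsto' hx fun i => (hfD _).nonneg x
    simpa only [q, max_eq_left h0] using hx
  have hfatou : ∫⁻ x, ENNReal.ofReal (klFun (q x)) ∂μ ≤ ENNReal.ofReal m := by
    calc ∫⁻ x, ENNReal.ofReal (klFun (q x)) ∂μ
        = ∫⁻ x, liminf (fun i => ENNReal.ofReal (klFun (f (ns i) x))) atTop ∂μ := by
          refine lintegral_congr_ae ?_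
          filter_upwards [hconv] with x hx
          exact (((ENNReal.continuous_ofReal.comp continuous_klFun).tendsto _).comp
            hx).liminf_eq.symm
      _ ≤ liminf (fun i => ∫⁻ x, ENNReal.ofReal (klFun (f (ns i) x)) ∂μ) atTop :=
          lintegral_liminf_le fun i =>
            (measurable_klFun.comp (hfD _).measurable).ennreal_ofReal
      _ = liminf (fun i => ENNReal.ofReal (y (ns i))) atTop := by
          congr 1
          ext i
          rw [← hfy, ofReal_integral_eq_lintegral_ofReal (hfI _)
            (Eventually.of_forall fun x => klFun_nonneg ((hfD _).nonneg x))]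
      _ = ENNReal.ofReal m :=
          ((ENNReal.continuous_ofReal.tendsto _).comp (hy.comp hns.tendsto_atTop)).liminf_eq
  have hnn : 0 ≤ᵐ[μ] fun x => klFun (q x) :=
    Eventually.of_forall fun x => klFun_nonneg (hqD.nonneg x)
  have hqI : Integrable (fun x => klFun (q x)) μ := by
    refine ⟨(measurable_klFun.comp hqm).aestronglyMeasurable, ?_⟩
    rw [hasFiniteIntegral_iff_ofReal hnn]
    exact hfatou.trans_lt ENNReal.ofReal_lt_top
  refine ⟨q, hqD, hqI, fun p' hp' hI' => le_trans ?_ (hm p' hp' hI')⟩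
  rw [← ofReal_integral_eq_lintegral_ofReal hqI hnn] at hfatou
  refine (ENNReal.ofReal_le_ofReal_iff ?_).1 hfatou
  exact le_csInf ⟨_, p, hp, hF, rfl⟩ fun _ ⟨q, hq, _, h⟩ =>
    h ▸ integral_nonneg fun x => klFun_nonneg (hq.nonneg x)

/-- If some feasible density of finite entropy is positive almost everywhere, so is the
minimizer. -/
theorem IsEntropyMinimizer.ae_pos (hψ : BoundedTests ψ) (hp : IsEntropyMinimizer μ ψ c p)
    (hp' : IsConstrainedDensity μ ψ c p') (hF' : Integrable (fun x => klFun (p' x)) μ)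
    (hpos : ∀ᵐ x ∂μ, 0 < p' x) : ∀ᵐ x ∂μ, 0 < p x := by
  have hAm : MeasurableSet {x | p x = 0} := hp.density.measurable (measurableSet_singleton 0)
  set A := {x | p x = 0}
  -- Moving a fraction `t` from `p` towards `p'` changes the entropy by at most `O(t)` by convexity,
  -- plus `t log t ∫_A p'` from the zero set `A` of `p`. Minimality, divided by `t`, gives the
  -- bound; as `t → 0` it fails unless `∫_A p' = 0`.
  have hbound : ∀ t : ℝ, 0 < t → t < 1 →
      -(∫ x, klFun (p' x) ∂μ) ≤ Real.log t * ∫ x in A, p' x ∂μ := by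
    intro t ht ht1
    have h1t : 0 ≤ 1 - t := by linarith
    have hle := hp.le _ (hp.density.convexComb hψ hp' h1t ht.le (by ring))
      (hp.density.integrable_klFun_convexComb hp' hp.integrable hF' h1t ht.le (by ring))
    have hi : Integrable (A.indicator p') μ := hp'.integrable.indicator hAm
    have hcc : Integrable (fun x => (1 - t) * klFun (p x) + t * klFun (p' x)) μ :=
      (hp.integrable.const_mul _).add (hF'.const_mul _)
    have hup : ∫ x, klFun ((1 - t) * p x + t * p' x) ∂μ
        ≤ ∫ x, ((1 - t) * klFun (p x) + t * klFun (p' x)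
          + t * Real.log t * A.indicator p' x) ∂μ := by
      refine integral_mono_ae (hp.density.integrable_klFun_convexComb hp' hp.integrable hF' h1t
        ht.le (by ring)) (hcc.add (hi.const_mul _)) ?_
      filter_upwards [hpos] with x hx
      by_cases hxA : x ∈ A
      · have h0 : p x = 0 := hxA
        simp only [h0, Set.indicator_of_mem hxA, klFun_apply, mul_zero, zero_add,
          Real.log_mul ht.ne' hx.ne']
        apply le_of_eq
        ring
      · simp only [Set.indicator_of_notMem hxA, mul_zero, add_zero]
        exact klFun_convexComb_le (hp.density.nonneg x) (hp'.nonneg x) h1t ht.le (by ring)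
    rw [integral_add hcc (hi.const_mul _), integral_add (hp.integrable.const_mul _)
      (hF'.const_mul _), integral_const_mul, integral_const_mul, integral_const_mul,
      integral_indicator hAm] at hup
    have h0 : 0 ≤ ∫ x, klFun (p x) ∂μ :=
      integral_nonneg fun x => klFun_nonneg (hp.density.nonneg x)
    have : 0 ≤ t * (∫ x, klFun (p' x) ∂μ + Real.log t * ∫ x in A, p' x ∂μ) := by
      nlinarith [mul_nonneg ht.le h0]
    linarith [nonneg_of_mul_nonneg_right this ht]
  have hzero : ∫ x in A, p' x ∂μ = 0 := by
    by_contra hne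
    have hI : 0 < ∫ x in A, p' x ∂μ :=
      lt_of_le_of_ne (integral_nonneg fun x => hp'.nonneg x) (Ne.symm hne)
    have htend : Tendsto (fun t => Real.log t * ∫ x in A, p' x ∂μ) (𝓝[>] 0) atBot :=
      Real.tendsto_log_nhdsGT_zero.atBot_mul_const hI
    have h1 := htend.eventually (eventually_lt_atBot (-(∫ x, klFun (p' x) ∂μ)))
    have h2 : ∀ᶠ t : ℝ in 𝓝[>] 0, t ∈ Set.Ioo (0 : ℝ) 1 := Ioo_mem_nhdsGT one_pos
    obtain ⟨t, h1, h2⟩ := (h1.and h2).exists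
    exact absurd h1 (not_lt.2 (hbound t h2.1 h2.2))
  rw [setIntegral_eq_zero_iff_of_nonneg_ae (Eventually.of_forall fun x => hp'.nonneg x)
    hp'.integrable.integrableOn, EventuallyEq, ae_restrict_iff' hAm] at hzero
  filter_upwards [hzero, hpos] with x h1 h2
  refine lt_of_le_of_ne (hp.density.nonneg x) fun h => ?_
  exact h2.ne' (h1 h.symm)

/-- A first-order expansion with quadratic remainder, from `log ((a + x) / a) ≤ x / a`. It lets the
first variation be computed without differentiating under the integral. -/
lemma klFun_add_le {a x : ℝ} (ha : 0 < a) (hax : 0 ≤ a + x) :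
    klFun (a + x) ≤ klFun a + x * Real.log a + x ^ 2 / a := by
  rcases hax.eq_or_lt with h | h
  · obtain rfl : x = -a := by linarith
    simp only [klFun_apply]
    field_simp
    simp
    linarith
  have h1 : Real.log ((a + x) / a) ≤ (a + x) / a - 1 := Real.log_le_sub_one_of_pos (by positivity)
  rw [Real.log_div h.ne' ha.ne'] at h1
  have h2 : (a + x) * ((a + x) / a - 1) = x + x ^ 2 / a := by
    field_simp
    ring
  simp only [klFun_apply]
  nlinarith [mul_le_mul_of_nonneg_left h1 h.le]

lemma abs_log_le_of_mem_Icc_inv {ε a : ℝ} (hε : 0 < ε) (h1 : ε ≤ a) (h2 : a ≤ ε⁻¹) :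
    |Real.log a| ≤ |Real.log ε| := by
  have h3 := Real.log_le_log hε h1
  have h4 := Real.log_le_log (hε.trans_le h1) h2
  rw [Real.log_inv] at h4
  rw [abs_of_nonpos (by linarith : Real.log ε ≤ 0)]
  exact abs_le.2 ⟨by linarith, h4⟩

/-- First-order condition: `log p` is orthogonal to every admissible bounded variation
concentrated where `p` is bounded away from `0` and `∞`. -/
theorem IsEntropyMinimizer.integral_mul_log_eq_zero [IsProbabilityMeasure μ]
    (hψ : BoundedTests ψ)
    (hp : IsEntropyMinimizer μ ψ c p) {κ : Ω → ℝ} (hκ : Measurable κ) {B ε : ℝ} (hε : 0 < ε)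
    (hB : ∀ x, |κ x| ≤ B) (hsupp : ∀ x, κ x ≠ 0 → ε ≤ p x ∧ p x ≤ ε⁻¹)
    (hκ1 : ∫ x, κ x ∂μ = 0) (hκψ : ∀ k, ∫ x, ψ k x * κ x ∂μ = 0) :
    ∫ x, κ x * Real.log (p x) ∂μ = 0 := by
  have hκi : Integrable κ μ :=
    Integrable.of_bound hκ.aestronglyMeasurable B (Eventually.of_forall hB)
  have hB0 : 0 ≤ B := by
    obtain ⟨x⟩ := μ.nonempty_of_neZero
    exact (abs_nonneg _).trans (hB x)
  have hκlog : Integrable (fun x => κ x * Real.log (p x)) μ := by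
    refine Integrable.of_bound
      (hκ.mul (Real.measurable_log.comp hp.density.measurable)).aestronglyMeasurable
      (B * |Real.log ε|) (Eventually.of_forall fun x => ?_)
    rw [Real.norm_eq_abs, abs_mul]
    by_cases h0 : κ x = 0
    · simp only [h0, abs_zero, zero_mul]; positivity
    exact mul_le_mul (hB x) (abs_log_le_of_mem_Icc_inv hε (hsupp x h0).1 (hsupp x h0).2)
      (abs_nonneg _) hB0
  set J := ∫ x, κ x * Real.log (p x) ∂μ
  -- For such `t` the variation `p + t κ` stays nonnegative, because `κ` lives where `p ≥ ε`; the
  -- constraints are kept since `κ` annihilates the tests.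
  have hstep : ∀ t : ℝ, |t| * B ≤ ε → 0 ≤ t * J + t ^ 2 * (B ^ 2 / ε) := by
    intro t ht
    have hnn : ∀ x, 0 ≤ p x + t * κ x := fun x => by
      by_cases h0 : κ x = 0
      · simpa [h0] using hp.density.nonneg x
      have h1 := (hsupp x h0).1
      have h2 : |t * κ x| ≤ ε := by
        rw [abs_mul]
        exact (mul_le_mul_of_nonneg_left (hB x) (abs_nonneg _)).trans ht
      linarith [neg_abs_le (t * κ x)]
    have hm : Measurable fun x => p x + t * κ x := hp.density.measurable.add (hκ.const_mul t)
    have hD : IsConstrainedDensity μ ψ c fun x => p x + t * κ x := by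
      refine ⟨hm, hnn, hp.density.integrable.add (hκi.const_mul t), ?_, fun k => ?_⟩
      · rw [integral_add hp.density.integrable (hκi.const_mul t), integral_const_mul, hκ1,
          hp.density.integral_eq_one]
        ring
      · have : ∀ x, ψ k x * (p x + t * κ x) = ψ k x * p x + t * (ψ k x * κ x) := fun x => by ring
        simp_rw [this]
        rw [integral_add (hψ.integrable_mul k hp.density.integrable)
          ((hψ.integrable_mul k hκi).const_mul t), integral_const_mul, hκψ,
          hp.density.integral_mul]
        ring
    have hup : ∀ x, klFun (p x + t * κ x)
        ≤ klFun (p x) + t * (κ x * Real.log (p x)) + t ^ 2 * (B ^ 2 / ε) := fun x => by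
      by_cases h0 : κ x = 0
      · simp only [h0, mul_zero, zero_mul, add_zero, le_add_iff_nonneg_right]
        positivity
      have h1 := (hsupp x h0).1
      have hpx : 0 < p x := hε.trans_le h1
      refine (klFun_add_le hpx (hnn x)).trans ?_
      have h2 : (t * κ x) ^ 2 / p x ≤ t ^ 2 * (B ^ 2 / ε) := by
        rw [mul_pow, mul_div_assoc]
        have h3 : κ x ^ 2 ≤ B ^ 2 := sq_le_sq' (neg_le_of_abs_le (hB x)) (le_of_abs_le (hB x))
        gcongr
      linarith [mul_assoc t (κ x) (Real.log (p x))]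
    have hi1 : Integrable (fun x => klFun (p x) + t * (κ x * Real.log (p x))) μ :=
      hp.integrable.add (hκlog.const_mul t)
    have hi : Integrable (fun x => klFun (p x) + t * (κ x * Real.log (p x))
        + t ^ 2 * (B ^ 2 / ε)) μ := hi1.add (integrable_const _)
    have hI := integrable_klFun_of_le hm hnn hi (Eventually.of_forall hup)
    have h1 := hp.le _ hD hI
    have h2 := integral_mono hI hi hup
    rw [integral_add hi1 (integrable_const _), integral_add hp.integrable (hκlog.const_mul t),
      integral_const_mul, integral_const, probReal_univ, one_smul] at h2
    linarith
  by_contra hJ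
  set Q := B ^ 2 / ε
  have hQ : 0 ≤ Q := by positivity
  -- At this size the linear term dominates, so the step `±s` of sign opposite to `J` contradicts
  -- `hstep`.
  obtain ⟨s, hs, hsB, hsQ⟩ : ∃ s : ℝ, 0 < s ∧ s * B ≤ ε ∧ s * Q < |J| := by
    have hJ' := abs_pos.2 hJ
    refine ⟨min (ε / (B + 1)) (|J| / (Q + 1)), by positivity, ?_, ?_⟩
    · calc _ ≤ ε / (B + 1) * B := mul_le_mul_of_nonneg_right (min_le_left _ _) hB0
        _ ≤ ε := by
          rw [div_mul_eq_mul_div, div_le_iff₀ (by positivity)]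
          nlinarith
    · calc _ ≤ |J| / (Q + 1) * Q := mul_le_mul_of_nonneg_right (min_le_right _ _) hQ
        _ < |J| := by
          rw [div_mul_eq_mul_div, div_lt_iff₀ (by positivity)]
          nlinarith
  rcases lt_or_gt_of_ne hJ with h | h
  · have := hstep s (by rwa [abs_of_pos hs])
    rw [abs_of_neg h] at hsQ
    nlinarith [mul_lt_mul_of_pos_left hsQ hs]
  · have := hstep (-s) (by rwa [abs_neg, abs_of_pos hs])
    rw [abs_of_pos h] at hsQ
    nlinarith [mul_lt_mul_of_pos_left hsQ hs]

end Abstract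

/-! ### Linear algebra -/

section LinearAlgebra

open Filter

/-- If the linear functionals `θ n` are eventually constant at each of certain vectors, a single
functional takes all these eventual values. -/
lemma exists_functional_of_eventually_eq {q : ℕ} (θ : ℕ → Fin q → ℝ) :
    ∃ θ' : Fin q → ℝ, ∀ (v : Fin q → ℝ) (l : ℝ),
      (∀ᶠ n in atTop, ∑ j, θ n j * v j = l) → ∑ j, θ' j * v j = l := by
  -- The `θ n` need not converge. The vectors at which they are eventually constant form a subspace
  -- on which the eventual value is linear, and this functional extends to the whole space.
  let W : Submodule ℝ (Fin q → ℝ) :=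
    { carrier := {v | ∃ l, ∀ᶠ n in atTop, ∑ j, θ n j * v j = l}
      add_mem' := by
        rintro v w ⟨l, hl⟩ ⟨l', hl'⟩
        refine ⟨l + l', ?_⟩
        filter_upwards [hl, hl'] with n h h'
        simp [mul_add, Finset.sum_add_distrib, h, h']
      zero_mem' := ⟨0, by simp⟩
      smul_mem' := by
        rintro a v ⟨l, hl⟩
        refine ⟨a * l, ?_⟩
        filter_upwards [hl] with n h
        rw [← h, Finset.mul_sum]
        exact Finset.sum_congr rfl fun j _ => by simp only [Pi.smul_apply, smul_eq_mul]; ring }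
  choose g hg using fun v : W => v.2
  have huniq : ∀ (v : W) (l : ℝ), (∀ᶠ n in atTop, ∑ j, θ n j * v.1 j = l) → g v = l := by
    intro v l h
    obtain ⟨n, h1, h2⟩ := ((hg v).and h).exists
    rw [← h1, h2]
  let f : W →ₗ[ℝ] ℝ :=
    { toFun := g
      map_add' := fun v w => huniq _ _ <| by
        filter_upwards [hg v, hg w] with n h h'
        simp [mul_add, Finset.sum_add_distrib, h, h']
      map_smul' := fun a v => huniq _ _ <| by
        filter_upwards [hg v] with n h
        rw [RingHom.id_apply, smul_eq_mul, ← h, Finset.mul_sum]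
        exact Finset.sum_congr rfl fun j _ => by
          simp only [Submodule.coe_smul, Pi.smul_apply, smul_eq_mul]; ring }
  obtain ⟨F, hF⟩ := f.exists_extend
  refine ⟨fun j => F (Pi.single j 1), fun v l h => ?_⟩
  have h1 : F v = l := by
    have : F v = f ⟨v, l, h⟩ := by rw [← hF]; rfl
    rw [this]
    exact huniq ⟨v, l, h⟩ l h
  rw [← h1, LinearMap.pi_apply_eq_sum_univ F v]
  refine Finset.sum_congr rfl fun j _ => ?_
  rw [smul_eq_mul, mul_comm]
  have hj : (Pi.single j 1 : Fin q → ℝ) = fun i => if j = i then 1 else 0 := by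
    ext i
    simp [Pi.single_apply, eq_comm]
  simp only [hj]

/-- Orthogonal projection of a square-integrable function onto the span of finitely many. -/
lemma exists_integral_residual_mul_eq_zero {Ω : Type*} [MeasurableSpace Ω] {μ : Measure Ω}
    {q : ℕ} {G : Ω → ℝ} {ψ : Fin q → Ω → ℝ} (hG : MemLp G 2 μ) (hψ : ∀ j, MemLp (ψ j) 2 μ) :
    ∃ θ : Fin q → ℝ, ∀ j, ∫ x, (G x - ∑ i, θ i * ψ i x) * ψ j x ∂μ = 0 := by
  let v : Fin q → Lp ℝ 2 μ := fun j => (hψ j).toLp (ψ j)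
  let K : Submodule ℝ (Lp ℝ 2 μ) := Submodule.span ℝ (Set.range v)
  have : FiniteDimensional ℝ K := FiniteDimensional.span_of_finite ℝ (Set.finite_range v)
  let g : Lp ℝ 2 μ := hG.toLp G
  obtain ⟨θ, hθ⟩ := (Submodule.mem_span_range_iff_exists_fun ℝ).1
    (K.starProjection_apply_mem g)
  refine ⟨θ, fun j => ?_⟩
  have horth : inner ℝ (v j) (g - K.starProjection g) = 0 :=
    K.sub_starProjection_mem_orthogonal g (v j) (Submodule.subset_span ⟨j, rfl⟩)
  rw [← hθ, L2.inner_def] at horth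
  rw [← horth]
  refine integral_congr_ae ?_
  have hsum : ⇑(∑ i, θ i • v i) =ᵐ[μ] fun x => ∑ i, θ i * ψ i x := by
    have h1 : ∀ s : Finset (Fin q), ⇑(∑ i ∈ s, θ i • v i) =ᵐ[μ] fun x => ∑ i ∈ s, θ i * ψ i x := by
      intro s
      induction s using Finset.induction_on with
      | empty =>
        filter_upwards [Lp.coeFn_zero ℝ 2 μ] with x hx
        simpa using hx
      | insert a s ha ih =>
        rw [Finset.sum_insert ha]
        filter_upwards [ih, Lp.coeFn_add (θ a • v a) (∑ i ∈ s, θ i • v i),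
          Lp.coeFn_smul (θ a) (v a), (hψ a).coeFn_toLp] with x h1 h2 h3 h4
        rw [h2, Pi.add_apply, h1, h3, Pi.smul_apply, h4, Finset.sum_insert ha, smul_eq_mul]
    exact h1 Finset.univ
  filter_upwards [hsum, Lp.coeFn_sub g (∑ i, θ i • v i), hG.coeFn_toLp, (hψ j).coeFn_toLp]
    with x h1 h2 h3 h4
  rw [h2, Pi.sub_apply, h1, h3, h4]
  simp

end LinearAlgebra

/-! ### Mixed points and interactions -/

section Mixing

variable {d q : ℕ}

/-- The point with coordinates in `s` taken from the first point and the others from the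
second. -/
def mixPoint (s : Finset (Fin d)) (x : Cube d × Cube d) : Cube d :=
  fun i => if i ∈ s then x.1 i else x.2 i

/-- Exchange the coordinates outside `s` of two points. -/
def exchangeOff (s : Finset (Fin d)) (x : Cube d × Cube d) : Cube d × Cube d :=
  (mixPoint s x, mixPoint s x.swap)

lemma exchangeOff_exchangeOff (s : Finset (Fin d)) (x : Cube d × Cube d) :
    exchangeOff s (exchangeOff s x) = x := by
  ext i <;> by_cases h : i ∈ s <;> simp [exchangeOff, mixPoint, h]

lemma mixPoint_exchangeOff (s : Finset (Fin d)) (x : Cube d × Cube d) :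
    mixPoint s (exchangeOff s x) = x.1 :=
  congrArg Prod.fst (exchangeOff_exchangeOff s x)

lemma measurable_mixPoint (s : Finset (Fin d)) : Measurable (mixPoint s) := by
  refine measurable_pi_lambda _ fun i => ?_
  by_cases h : i ∈ s <;> simp only [mixPoint, h, if_true, if_false] <;> fun_prop

/-- On each pair of matching coordinates the map is the identity or the swap of `I × I`. -/
lemma measurePreserving_exchangeOff (s : Finset (Fin d)) :
    MeasurePreserving (exchangeOff s) (volume : Measure (Cube d × Cube d)) volume := by
  have h1 := volume_measurePreserving_arrowProdEquivProdArrow I I (Fin d)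
  have h2 : MeasurePreserving (fun (a : Fin d → I × I) i =>
      (if i ∈ s then (id : I × I → I × I) else Prod.swap) (a i)) volume volume := by
    refine volume_preserving_pi (α' := fun _ : Fin d => I × I) (β' := fun _ : Fin d => I × I)
      (f := fun i => if i ∈ s then (id : I × I → I × I) else Prod.swap) fun i => ?_
    split_ifs
    · exact MeasurePreserving.id _
    · exact Measure.measurePreserving_swap
  have h3 := (h1.comp h2).comp (h1.symm _)
  have heq : exchangeOff s = (MeasurableEquiv.arrowProdEquivProdArrow I I (Fin d) ∘
      fun (a : Fin d → I × I) i => (if i ∈ s then (id : I × I → I × I) else Prod.swap) (a i)) ∘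
      (MeasurableEquiv.arrowProdEquivProdArrow I I (Fin d)).symm := by
    funext x
    refine Prod.ext (funext fun i => ?_) (funext fun i => ?_) <;> by_cases h : i ∈ s <;>
      simp [exchangeOff, mixPoint, h, MeasurableEquiv.arrowProdEquivProdArrow,
        Equiv.arrowProdEquivProdArrow]
  rw [heq]
  exact h3

lemma measurePreserving_mixPoint (s : Finset (Fin d)) :
    MeasurePreserving (mixPoint s) (volume : Measure (Cube d × Cube d)) volume :=
  measurePreserving_fst.comp (measurePreserving_exchangeOff s)

/-- Coordinate sets entering the interaction: all, none, and the singletons. -/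
def interactionSet : Option (Option (Fin d)) → Finset (Fin d)
  | none => Finset.univ
  | some none => ∅
  | some (some i) => {i}

/-- Coefficients of the interaction. -/
def interactionCoeff : Option (Option (Fin d)) → ℝ
  | none => 1
  | some none => d - 1
  | some (some _) => -1

/-- The part of `F` relative to a base point that is not a sum of functions of one coordinate. -/
noncomputable def interaction (F : Cube d → ℝ) (x : Cube d × Cube d) : ℝ :=
  ∑ k, interactionCoeff k * F (mixPoint (interactionSet k) x)

lemma mixPoint_univ (x : Cube d × Cube d) : mixPoint Finset.univ x = x.1 := by
  ext i; simp [mixPoint]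

lemma mixPoint_empty (x : Cube d × Cube d) : mixPoint ∅ x = x.2 := by
  ext i; simp [mixPoint]

lemma interaction_eq (F : Cube d → ℝ) (x : Cube d × Cube d) :
    interaction F x = F x.1 + ((d - 1) * F x.2 - ∑ i, F (mixPoint {i} x)) := by
  simp [interaction, Fintype.sum_option, interactionSet, interactionCoeff, mixPoint_univ,
    mixPoint_empty, sub_eq_add_neg]

/-- Of the `d` singleton mixtures, one sees `x.1 i` and the other `d - 1` see `x.2 i`; the
coefficients cancel both. -/
lemma interaction_coord (i : Fin d) (g : I → ℝ) (x : Cube d × Cube d) :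
    interaction (fun u => g (u i)) x = 0 := by
  have : ∀ j, g (mixPoint {j} x i) = g (x.2 i) + if j = i then g (x.1 i) - g (x.2 i) else 0 := by
    intro j
    by_cases h : j = i
    · simp [mixPoint, h]
    · simp [mixPoint, h, Ne.symm h]
  simp_rw [interaction_eq, this, Finset.sum_add_distrib]
  simp
  ring

lemma interaction_const (a : ℝ) (x : Cube d × Cube d) : interaction (fun _ => a) x = 0 := by
  simp [interaction_eq]
  ring

lemma interaction_sub_sum (F : Cube d → ℝ) (θ : Fin q → ℝ) (ψ : Fin q → Cube d → ℝ)
    (x : Cube d × Cube d) :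
    interaction (fun u => F u - ∑ j, θ j * ψ j u) x
      = interaction F x - ∑ j, θ j * interaction (ψ j) x := by
  simp only [interaction, mul_sub, Finset.sum_sub_distrib, Finset.mul_sum]
  congr 1
  rw [Finset.sum_comm]
  exact Finset.sum_congr rfl fun j _ => Finset.sum_congr rfl fun k _ => by ring

lemma measurable_interaction {F : Cube d → ℝ} (hF : Measurable F) :
    Measurable (interaction F) :=
  Finset.measurable_fun_sum _ fun _ _ => (hF.comp (measurable_mixPoint _)).const_mul _

lemma abs_sum_interactionCoeff_le {y : Option (Option (Fin d)) → ℝ} {C : ℝ}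
    (h : ∀ k, |y k| ≤ C) :
    |∑ k, interactionCoeff k * y k| ≤ (∑ k : Option (Option (Fin d)), |interactionCoeff k|) * C := by
  refine (Finset.abs_sum_le_sum_abs _ _).trans ?_
  rw [Finset.sum_mul]
  refine Finset.sum_le_sum fun k _ => ?_
  rw [abs_mul]
  exact mul_le_mul_of_nonneg_left (h k) (abs_nonneg _)

/-- The adjoint of the interaction operator. -/
noncomputable def interactionAdjoint (w : Cube d × Cube d → ℝ) (v : Cube d) : ℝ :=
  ∫ v', ∑ k, interactionCoeff k * w (exchangeOff (interactionSet k) (v, v'))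

variable {w : Cube d × Cube d → ℝ}

lemma measurable_exchange_sum (hw : Measurable w) : Measurable fun x : Cube d × Cube d =>
    ∑ k, interactionCoeff k * w (exchangeOff (interactionSet k) x) :=
  Finset.measurable_fun_sum _ fun _ _ =>
    (hw.comp (measurePreserving_exchangeOff _).measurable).const_mul _

lemma measurable_interactionAdjoint (hw : Measurable w) : Measurable (interactionAdjoint w) :=
  (measurable_exchange_sum hw).stronglyMeasurable.integral_prod_right'.measurable

lemma abs_interactionAdjoint_le {C : ℝ} (hC : ∀ x, |w x| ≤ C) (v : Cube d) :
    |interactionAdjoint w v| ≤ (∑ k : Option (Option (Fin d)), |interactionCoeff k|) * C := by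
  have := norm_integral_le_of_norm_le_const (μ := (volume : Measure (Cube d)))
    (f := fun v' => ∑ k, interactionCoeff k * w (exchangeOff (interactionSet k) (v, v')))
    (Filter.Eventually.of_forall fun v' => abs_sum_interactionCoeff_le fun k => hC _)
  rwa [probReal_univ, mul_one] at this

/-- As the exchange is an involution, `v` is itself a mixed point of each exchanged pair at which
`w` is evaluated. -/
lemma interactionAdjoint_support {A : Set (Cube d)}
    (hA : ∀ x, w x ≠ 0 → ∀ k, mixPoint (interactionSet k) x ∈ A) {v : Cube d}
    (hv : interactionAdjoint w v ≠ 0) : v ∈ A := by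
  by_contra hvA
  refine hv ?_
  have : ∀ v' k, w (exchangeOff (interactionSet k) (v, v')) = 0 := by
    intro v' k
    by_contra h
    have := hA _ h k
    rw [mixPoint_exchangeOff] at this
    exact hvA this
  simp [interactionAdjoint, this]

/-- The measure-preserving exchange moves the mixing from `F` to `w`, term by term; integrating out
the second point leaves the adjoint. -/
lemma integral_mul_interactionAdjoint (hw : Measurable w) {C : ℝ} (hC : ∀ x, |w x| ≤ C)
    {F : Cube d → ℝ} (hF : Measurable F) {B : ℝ} (hB : ∀ u, |F u| ≤ B) :
    ∫ v, F v * interactionAdjoint w v = ∫ x, w x * interaction F x := by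
  have hbd : ∀ {g : Cube d × Cube d → ℝ}, Measurable g → (∀ x, |g x| ≤ C) →
      ∀ {f : Cube d × Cube d → ℝ}, Measurable f → (∀ x, |f x| ≤ B) →
      Integrable (fun x => g x * f x) := fun hg hgC _ hf hfB =>
    Integrable.of_bound (hg.mul hf).aestronglyMeasurable (C * B)
      (Filter.Eventually.of_forall fun x => by
        rw [Real.norm_eq_abs, abs_mul]
        exact mul_le_mul (hgC x) (hfB x) (abs_nonneg _) ((abs_nonneg _).trans (hgC x)))
  have hk : ∀ k : Option (Option (Fin d)), ∫ x : Cube d × Cube d,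
      w (exchangeOff (interactionSet k) x) * F x.1
      = ∫ x, w x * F (mixPoint (interactionSet k) x) := by
    intro k
    have hmp := measurePreserving_exchangeOff (interactionSet k)
    have hmeas : Measurable fun x => w x * F (mixPoint (interactionSet k) x) :=
      hw.mul (hF.comp (measurable_mixPoint _))
    have := integral_map (μ := (volume : Measure (Cube d × Cube d)))
      hmp.measurable.aemeasurable (f := fun x => w x * F (mixPoint (interactionSet k) x))
      hmeas.aestronglyMeasurable
    rw [hmp.map_eq] at this
    rw [this]
    simp only [mixPoint_exchangeOff]
  have hi1 : ∀ k : Option (Option (Fin d)), Integrable fun x : Cube d × Cube d =>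
      w (exchangeOff (interactionSet k) x) * F x.1 := fun k =>
    hbd (hw.comp (measurePreserving_exchangeOff _).measurable) (fun x => hC _)
      (hF.comp measurable_fst) (fun x => hB _)
  have hi2 : ∀ k : Option (Option (Fin d)), Integrable fun x : Cube d × Cube d =>
      w x * F (mixPoint (interactionSet k) x) := fun k =>
    hbd hw hC (hF.comp (measurable_mixPoint _)) (fun x => hB _)
  calc ∫ v, F v * interactionAdjoint w v
      = ∫ v, ∫ v', ∑ k, interactionCoeff k *
          (w (exchangeOff (interactionSet k) (v, v')) * F v) := by
        refine integral_congr_ae (Filter.Eventually.of_forall fun v => ?_)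
        simp only [interactionAdjoint]
        rw [← integral_const_mul]
        refine integral_congr_ae (Filter.Eventually.of_forall fun v' => ?_)
        simp only [Finset.mul_sum]
        exact Finset.sum_congr rfl fun k _ => by ring
    _ = ∫ x : Cube d × Cube d, ∑ k, interactionCoeff k *
          (w (exchangeOff (interactionSet k) x) * F x.1) := by
        rw [Measure.volume_eq_prod, integral_prod]
        exact integrable_finsetSum _ fun k _ => (hi1 k).const_mul _
    _ = ∫ x, ∑ k, interactionCoeff k * (w x * F (mixPoint (interactionSet k) x)) := by
        rw [integral_finsetSum _ fun k _ => (hi1 k).const_mul _,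
          integral_finsetSum _ fun k _ => (hi2 k).const_mul _]
        simp_rw [integral_const_mul, hk]
    _ = ∫ x, w x * interaction F x := by
        refine integral_congr_ae (Filter.Eventually.of_forall fun x => ?_)
        simp only [interaction, Finset.mul_sum]
        exact Finset.sum_congr rfl fun k _ => by ring

end Mixing

/-! ### The structure of the minimizer on the cube -/

section Structure

open Filter Topology

variable {d q : ℕ}

/-- The test functions of the problem: indicators of one coordinate, and the moment functions. -/
noncomputable def copulaTest (φ : Cube d → Fin q → ℝ) :
    (Fin d × {A : Set I // MeasurableSet A}) ⊕ Fin q → Cube d → ℝ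
  | .inl (i, A), u => A.1.indicator 1 (u i)
  | .inr j, u => φ u j

/-- The prescribed integrals of the test functions. -/
noncomputable def copulaTarget (α : Fin q → ℝ) :
    (Fin d × {A : Set I // MeasurableSet A}) ⊕ Fin q → ℝ
  | .inl (_, A) => (volume : Measure I).real A.1
  | .inr j => α j

lemma boundedTests_copulaTest {φ : Cube d → Fin q → ℝ} (hmeas : ∀ j, Measurable fun u => φ u j)
    (hbdd : ∃ C : ℝ, ∀ u j, |φ u j| ≤ C) : BoundedTests (copulaTest φ) where
  measurable := by
    rintro (⟨i, A⟩ | j)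
    · exact (measurable_one.indicator A.2).comp (measurable_pi_apply i)
    · exact hmeas j
  bounded := by
    rintro (⟨i, A⟩ | j)
    · refine ⟨1, fun u => ?_⟩
      by_cases h : u i ∈ A.1 <;> simp [copulaTest, h]
    · obtain ⟨C, hC⟩ := hbdd
      exact ⟨C, fun u => hC u j⟩

variable {φ : Cube d → Fin q → ℝ} {α : Fin q → ℝ} {p : Cube d → ℝ}

/-- Where the density of the minimizer is bounded away from `0` and `∞` at all mixed points, the
interaction of its logarithm is a linear combination of those of the moment functions. -/
lemma IsEntropyMinimizer.exists_interaction_log_eq_on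
    (hmeas : ∀ j, Measurable fun u => φ u j) (hbdd : ∃ C : ℝ, ∀ u j, |φ u j| ≤ C)
    (hp : IsEntropyMinimizer volume (copulaTest φ) (copulaTarget α) p) {ε : ℝ} (hε : 0 < ε) :
    ∃ θ : Fin q → ℝ, ∀ᵐ x : Cube d × Cube d,
      (∀ k, ε ≤ p (mixPoint (interactionSet k) x) ∧ p (mixPoint (interactionSet k) x) ≤ ε⁻¹) →
      ∑ j, θ j * interaction (fun u => φ u j) x = interaction (fun u => Real.log (p u)) x := by
  have hpm := hp.density.measurable
  let A : Set (Cube d) := {v | ε ≤ p v ∧ p v ≤ ε⁻¹}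
  have hA : MeasurableSet A :=
    (measurableSet_le measurable_const hpm).inter (measurableSet_le hpm measurable_const)
  let E : Set (Cube d × Cube d) := {x | ∀ k, mixPoint (interactionSet k) x ∈ A}
  have hE : MeasurableSet E := by
    simp only [E, Set.ofPred_forall]
    exact MeasurableSet.iInter fun k => measurable_mixPoint _ hA
  -- Truncation makes the logarithm bounded and costs nothing on `E`, where all mixed points lie in
  -- `A`.
  let L : Cube d → ℝ := A.indicator fun u => Real.log (p u)
  have hLm : Measurable L := (Real.measurable_log.comp hpm).indicator hA
  have hLb : ∀ u, |L u| ≤ |Real.log ε| := fun u => by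
    by_cases h : u ∈ A
    · simp only [L, Set.indicator_of_mem h]
      exact abs_log_le_of_mem_Icc_inv hε h.1 h.2
    · simp only [L, Set.indicator_of_notMem h, abs_zero]
      positivity
  have hLE : ∀ x ∈ E, interaction L x = interaction (fun u => Real.log (p u)) x := fun x hx =>
    Finset.sum_congr rfl fun k _ => by simp only [L, Set.indicator_of_mem (hx k)]
  obtain ⟨C, hC⟩ := hbdd
  have hind : ∀ {F : Cube d → ℝ} {B : ℝ}, (∀ u, |F u| ≤ B) → ∀ x, |E.indicator (interaction F) x|
      ≤ (∑ k : Option (Option (Fin d)), |interactionCoeff k|) * B := by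
    intro F B hF x
    have h := abs_sum_interactionCoeff_le (d := d)
      (y := fun k => F (mixPoint (interactionSet k) x)) fun k => hF _
    by_cases hx : x ∈ E
    · rw [Set.indicator_of_mem hx]
      exact h
    · rw [Set.indicator_of_notMem hx, abs_zero]
      exact (abs_nonneg _).trans h
  let G : Cube d × Cube d → ℝ := E.indicator (interaction L)
  let Ψ : Fin q → Cube d × Cube d → ℝ := fun j => E.indicator (interaction fun u => φ u j)
  have hGm : Measurable G := (measurable_interaction hLm).indicator hE
  have hΨm : ∀ j, Measurable (Ψ j) := fun j => (measurable_interaction (hmeas j)).indicator hE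
  have hΨb : ∀ j x, |Ψ j x| ≤ (∑ k : Option (Option (Fin d)), |interactionCoeff k|) * C :=
    fun j => hind fun u => hC u j
  obtain ⟨θ, hθ⟩ := exists_integral_residual_mul_eq_zero
    (MemLp.of_bound (p := 2) (μ := volume) hGm.aestronglyMeasurable _
      (Eventually.of_forall (hind hLb)))
    fun j => MemLp.of_bound (p := 2) (hΨm j).aestronglyMeasurable _
      (Eventually.of_forall (hΨb j))
  let w : Cube d × Cube d → ℝ := fun x => G x - ∑ j, θ j * Ψ j x
  have hwm : Measurable w :=
    hGm.sub (Finset.measurable_fun_sum _ fun j _ => (hΨm j).const_mul _)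
  obtain ⟨D, hD⟩ : ∃ D, ∀ x, |w x| ≤ D :=
    ⟨_, fun x => (abs_sub _ _).trans (add_le_add (hind hLb x)
      ((Finset.abs_sum_le_sum_abs _ _).trans (Finset.sum_le_sum fun j _ => by
        rw [abs_mul]
        exact mul_le_mul_of_nonneg_left (hΨb j x) (abs_nonneg _))))⟩
  have hwE : ∀ x, x ∉ E → w x = 0 := fun x hx => by simp [w, G, Ψ, hx]
  have hadj : ∀ {F : Cube d → ℝ} {B : ℝ}, Measurable F → (∀ u, |F u| ≤ B) →
      ∫ v, F v * interactionAdjoint w v = ∫ x, w x * E.indicator (interaction F) x := by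
    intro F B hF hB
    rw [integral_mul_interactionAdjoint hwm hD hF hB]
    refine integral_congr_ae (Eventually.of_forall fun x => ?_)
    by_cases hx : x ∈ E
    · simp [hx]
    · simp [hx, hwE x hx]
  have hsupp : ∀ v, interactionAdjoint w v ≠ 0 → ε ≤ p v ∧ p v ≤ ε⁻¹ := fun v hv =>
    interactionAdjoint_support (A := A)
      (fun x hx => by_contra fun h => hx (hwE x h)) hv
  -- `T* w` is admissible: `T` kills the constant and the coordinate indicators, and the choice of
  -- `θ` makes `w` orthogonal to each `T (φ j)` on `E`.
  have hlog : ∫ v, interactionAdjoint w v * Real.log (p v) = 0 := by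
    refine hp.integral_mul_log_eq_zero (boundedTests_copulaTest hmeas ⟨C, hC⟩)
      (measurable_interactionAdjoint hwm) hε (abs_interactionAdjoint_le hD) hsupp ?_ ?_
    · have := hadj (measurable_const (a := (1 : ℝ))) (B := 1) (by simp)
      simpa [interaction_const, Set.indicator_apply] using this
    · rintro (⟨i, S⟩ | j)
      · have := hadj (F := fun u => S.1.indicator 1 (u i)) (B := 1)
          ((measurable_one.indicator S.2).comp (measurable_pi_apply i))
          (fun u => by by_cases h : u i ∈ S.1 <;> simp [h])
        refine this.trans ?_
        have h0 : interaction (fun u : Cube d => S.1.indicator (1 : I → ℝ) (u i)) = 0 :=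
          funext (interaction_coord i _)
        simp [h0]
      · exact (hadj (hmeas j) fun u => hC u j).trans (hθ j)
  have hwG : ∫ x, w x * G x = 0 := by
    rw [← hadj hLm hLb, ← hlog]
    refine integral_congr_ae (Eventually.of_forall fun v => ?_)
    by_cases hv : interactionAdjoint w v = 0
    · simp [hv]
    · have hvA : v ∈ A := hsupp v hv
      simp only [L, Set.indicator_of_mem hvA]
      ring
  have hint : ∀ {f : Cube d × Cube d → ℝ} {B : ℝ}, Measurable f → (∀ x, |f x| ≤ B) →
      Integrable fun x => w x * f x := fun hf hB =>
    (Integrable.of_bound hf.aestronglyMeasurable _ (Eventually.of_forall hB)).bdd_mul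
      hwm.aestronglyMeasurable (Eventually.of_forall hD)
  -- `w` is a combination of `G` and the `Ψ j`, and is orthogonal to all of them.
  have hww : ∫ x, w x * w x = 0 := by
    have h1 : ∀ x, w x * w x = w x * G x - ∑ j, θ j * (w x * Ψ j x) := fun x => by
      conv_lhs => rw [show w x * w x = w x * (G x - ∑ j, θ j * Ψ j x) from rfl]
      rw [mul_sub, Finset.mul_sum]
      congr 1
      exact Finset.sum_congr rfl fun j _ => by ring
    simp_rw [h1]
    rw [integral_sub (hint hGm (hind hLb)) (integrable_finsetSum _ fun j _ =>
      (hint (hΨm j) (hΨb j)).const_mul _), hwG,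
      integral_finsetSum _ fun j _ => (hint (hΨm j) (hΨb j)).const_mul _]
    simp_rw [integral_const_mul]
    have : ∀ j, ∫ x, w x * Ψ j x = 0 := hθ
    simp [this]
  rw [integral_eq_zero_iff_of_nonneg (fun x => mul_self_nonneg _) (hint hwm hD)] at hww
  refine ⟨θ, ?_⟩
  filter_upwards [hww] with x hx hxE
  have hxE' : x ∈ E := hxE
  have h0 : w x = 0 := mul_self_eq_zero.1 hx
  simp only [w, G, Ψ, Set.indicator_of_mem hxE', hLE x hxE'] at h0
  linarith

/-- Each mixed point is uniformly distributed, so for almost every pair all mixed values of `p` are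
positive and lie within the cutoffs `1 / (n + 1)` and `n + 1` eventually. There the combinations
with coefficients `θ n` are eventually constant, so a single `θ` serves. -/
lemma IsEntropyMinimizer.exists_interaction_log_eq
    (hmeas : ∀ j, Measurable fun u => φ u j) (hbdd : ∃ C : ℝ, ∀ u j, |φ u j| ≤ C)
    (hp : IsEntropyMinimizer volume (copulaTest φ) (copulaTarget α) p)
    (hpos : ∀ᵐ u, 0 < p u) :
    ∃ θ : Fin q → ℝ, ∀ᵐ x : Cube d × Cube d,
      ∑ j, θ j * interaction (fun u => φ u j) x = interaction (fun u => Real.log (p u)) x := by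
  choose θ hθ using fun n : ℕ =>
    hp.exists_interaction_log_eq_on hmeas hbdd (Nat.one_div_pos_of_nat (α := ℝ) (n := n))
  obtain ⟨θ', hθ'⟩ := exists_functional_of_eventually_eq θ
  refine ⟨θ', ?_⟩
  have hmix : ∀ᵐ x : Cube d × Cube d, ∀ k, 0 < p (mixPoint (interactionSet k) x) :=
    ae_all_iff.2 fun k => (measurePreserving_mixPoint _).quasiMeasurePreserving.ae hpos
  filter_upwards [ae_all_iff.2 hθ, hmix] with x h1 h2
  refine hθ' (fun j => interaction (fun u => φ u j) x) _ ?_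
  have h3 : ∀ᶠ n : ℕ in atTop, ∀ k, 1 / ((n : ℝ) + 1) ≤ p (mixPoint (interactionSet k) x) ∧
      p (mixPoint (interactionSet k) x) ≤ (1 / ((n : ℝ) + 1))⁻¹ := by
    refine eventually_all.2 fun k => ?_
    have h4 := tendsto_one_div_add_atTop_nhds_zero_nat.eventually (ge_mem_nhds (h2 k))
    have h5 := (tendsto_natCast_atTop_atTop (R := ℝ)).eventually_ge_atTop
      (p (mixPoint (interactionSet k) x))
    filter_upwards [h4, h5] with n h4 h5
    refine ⟨h4, ?_⟩
    rw [one_div, inv_inv]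
    linarith
  filter_upwards [h3] with n hn
  exact h1 n hn

/-- An almost everywhere positive minimizer is an exponential of the moment functions times
functions of one coordinate. -/
theorem IsEntropyMinimizer.exists_exponential_form [NeZero q]
    (hmeas : ∀ j, Measurable fun u => φ u j) (hbdd : ∃ C : ℝ, ∀ u j, |φ u j| ≤ C)
    (hP1 : ∀ u, φ u 0 = 1)
    (hp : IsEntropyMinimizer volume (copulaTest φ) (copulaTarget α) p)
    (hpos : ∀ᵐ u, 0 < p u) :
    ∃ (θ : Fin q → ℝ) (f : Fin d → I → ℝ), (∀ i, Measurable (f i)) ∧ (∀ i t, 0 < f i t) ∧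
      p =ᵐ[volume] fun u => Real.exp (∑ j, θ j * φ u j) * ∏ i, f i (u i) := by
  obtain ⟨θ, hθ⟩ := hp.exists_interaction_log_eq hmeas hbdd hpos
  let G : Cube d → ℝ := fun u => Real.log (p u) - ∑ j, θ j * φ u j
  have hGm : Measurable G := (Real.measurable_log.comp hp.density.measurable).sub
    (Finset.measurable_fun_sum _ fun j _ => (hmeas j).const_mul _)
  have hG : ∀ᵐ x : Cube d × Cube d, interaction G x = 0 := by
    filter_upwards [hθ] with x hx
    rw [interaction_sub_sum, hx, sub_self]
  -- The base point is the second component, while `ae_ae_of_ae_prod` fixes the first; hence the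
  -- swap.
  have hG' : ∀ᵐ x : Cube d × Cube d, interaction G x.swap = 0 :=
    (Measure.measurePreserving_swap (μ := (volume : Measure (Cube d)))
      (ν := (volume : Measure (Cube d)))).quasiMeasurePreserving.ae hG
  obtain ⟨a, ha⟩ := (Measure.ae_ae_of_ae_prod hG').exists
  -- `T G (u, a) = 0` expresses `G u` through its values on the coordinate lines through `a`, up to
  -- the constant `-(d - 1) G a`, which goes into the coefficient of `φ 0 = 1`.
  refine ⟨fun j => θ j + if j = 0 then -((d - 1) * G a) else 0,
    fun i t => Real.exp (G (Function.update a i t)), fun i => ?_, fun i t => Real.exp_pos _, ?_⟩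
  · exact Real.measurable_exp.comp (hGm.comp (measurable_update a))
  · filter_upwards [ha, hpos] with u hu hpu
    rw [interaction_eq] at hu
    have hmix : ∀ i, mixPoint {i} (u, a) = Function.update a i (u i) := by
      intro i
      ext j
      by_cases h : j = i
      · subst h; simp [mixPoint]
      · simp [mixPoint, h]
    simp only [Prod.swap_prod_mk, hmix] at hu
    rw [← Real.exp_sum, ← Real.exp_add, ← Real.exp_log hpu]
    congr 1
    simp only [add_mul, Finset.sum_add_distrib, ite_mul, zero_mul, Finset.sum_ite_eq',
      Finset.mem_univ, if_true, hP1, mul_one]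
    have hGu : G u = Real.log (p u) - ∑ j, θ j * φ u j := rfl
    linarith

end Structure

/-! ### Copulas with a density of product form -/

section ProductForm

open Filter Topology

variable {d q : ℕ}

lemma measurePreserving_coord (i : Fin d) :
    MeasurePreserving (fun u : Cube d => u i) volume volume :=
  measurePreserving_eval (fun _ : Fin d => (volume : Measure I)) i

lemma lintegral_prod_coord {H : Fin d → I → ENNReal} (hH : ∀ i, Measurable (H i)) :
    ∫⁻ u : Cube d, ∏ i, H i (u i) = ∏ i, ∫⁻ t, H i t := by
  have hind : ProbabilityTheory.iIndepFun (fun i (u : Cube d) => H i (u i)) volume :=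
    ProbabilityTheory.iIndepFun_pi (μ := fun _ : Fin d => (volume : Measure I))
      fun i => (hH i).aemeasurable
  rw [ProbabilityTheory.lintegral_prod_eq_prod_lintegral_of_indepFun Finset.univ _ hind
    fun i => (hH i).comp (measurable_pi_apply i)]
  refine Finset.prod_congr rfl fun i _ => ?_
  exact (measurePreserving_coord i).lintegral_comp (hH i)

lemma setLIntegral_prod_coord {H : Fin d → I → ENNReal} (hH : ∀ i, Measurable (H i)) (i : Fin d)
    {S : Set I} (hS : MeasurableSet S) :
    ∫⁻ u in (fun u : Cube d => u i) ⁻¹' S, ∏ j, H j (u j)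
      = (∫⁻ t in S, H i t) * ∏ j ∈ Finset.univ.erase i, ∫⁻ t, H j t := by
  rw [← lintegral_indicator (measurable_pi_apply i hS), ← lintegral_indicator hS]
  have hm : ∀ j, Measurable (Function.update H i (S.indicator (H i)) j) := fun j => by
    by_cases h : j = i
    · subst h
      simpa using (hH j).indicator hS
    · simpa [h] using hH j
  have h1 : ∀ u : Cube d, ((fun u : Cube d => u i) ⁻¹' S).indicator (fun u => ∏ j, H j (u j)) u
      = ∏ j, Function.update H i (S.indicator (H i)) j (u j) := by
    intro u
    rw [← Finset.mul_prod_erase _ _ (Finset.mem_univ i), Function.update_self,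
      Finset.prod_congr rfl fun j hj => by
        rw [Function.update_of_ne (Finset.ne_of_mem_erase hj)]]
    by_cases hu : u i ∈ S
    · rw [Set.indicator_of_mem (show u ∈ (fun u : Cube d => u i) ⁻¹' S from hu),
        Set.indicator_of_mem hu,
        Finset.mul_prod_erase _ (fun j => H j (u j)) (Finset.mem_univ i)]
    · rw [Set.indicator_of_notMem (show u ∉ (fun u : Cube d => u i) ⁻¹' S from hu),
        Set.indicator_of_notMem hu, zero_mul]
  simp_rw [h1]
  rw [lintegral_prod_coord hm, ← Finset.mul_prod_erase _ _ (Finset.mem_univ i),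
    Function.update_self, Finset.prod_congr rfl fun j hj => by
      rw [Function.update_of_ne (Finset.ne_of_mem_erase hj)]]

/-- Uniform marginals force the factors of a product-type density to be bounded away from `0` and
`∞`. -/
theorem exists_abs_log_factor_le {E : Cube d → ℝ} {f : Fin d → I → ℝ} {B : ℝ}
    (hE : ∀ u, |E u| ≤ B) (hf : ∀ i, Measurable (f i)) (hpos : ∀ i t, 0 < f i t)
    (hmarg : ∀ i, (volume.withDensity fun u : Cube d =>
      ENNReal.ofReal (Real.exp (E u) * ∏ i, f i (u i))).map (fun u : Cube d => u i) = volume)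
    (i : Fin d) : ∃ M, ∀ᵐ t, |Real.log (f i t)| ≤ M := by
  let H : Fin d → I → ENNReal := fun j t => ENNReal.ofReal (f j t)
  have hH : ∀ j, Measurable (H j) := fun j => (hf j).ennreal_ofReal
  set R : ENNReal := ∏ j ∈ Finset.univ.erase i, ∫⁻ t, H j t
  have hdens : ∀ u : Cube d, ENNReal.ofReal (Real.exp (E u) * ∏ i, f i (u i))
      = ENNReal.ofReal (Real.exp (E u)) * ∏ j, H j (u j) := fun u => by
    rw [ENNReal.ofReal_mul (Real.exp_pos _).le,
      ENNReal.ofReal_prod_of_nonneg fun j _ => (hpos j _).le]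
  have hvol : ∀ S : Set I, MeasurableSet S → volume S =
      ∫⁻ u in (fun u : Cube d => u i) ⁻¹' S,
        ENNReal.ofReal (Real.exp (E u)) * ∏ j, H j (u j) := by
    intro S hS
    have hS' := measurable_pi_apply (X := fun _ : Fin d => I) i hS
    conv_lhs => rw [← hmarg i]
    rw [Measure.map_apply (measurable_pi_apply i) hS]
    simp_rw [hdens]
    exact withDensity_apply _ hS'
  have hprodm : Measurable fun u : Cube d => ∏ j, H j (u j) :=
    Finset.measurable_fun_prod _ fun j _ => (hH j).comp (measurable_pi_apply j)
  -- Replacing `exp (E u)` by its extreme values `exp (∓B)` leaves a product density with `i`-th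
  -- marginal density `R * H i`. Since the true marginal is uniform, `R * H i` lies between `exp
  -- (-B)` and `exp B` a.e.
  have hlow : ∀ S : Set I, MeasurableSet S →
      ENNReal.ofReal (Real.exp (-B)) * ((∫⁻ t in S, H i t) * R) ≤ volume S := by
    intro S hS
    rw [hvol S hS, ← setLIntegral_prod_coord hH i hS, ← lintegral_const_mul _ hprodm]
    refine lintegral_mono fun u => ?_
    gcongr
    exact (abs_le.1 (hE u)).1
  have hupp : ∀ S : Set I, MeasurableSet S →
      volume S ≤ ENNReal.ofReal (Real.exp B) * ((∫⁻ t in S, H i t) * R) := by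
    intro S hS
    rw [hvol S hS, ← setLIntegral_prod_coord hH i hS, ← lintegral_const_mul _ hprodm]
    refine lintegral_mono fun u => ?_
    gcongr
    exact (abs_le.1 (hE u)).2
  have hint_ne : ∀ j, ∫⁻ t, H j t ≠ 0 := fun j h => by
    rw [lintegral_eq_zero_iff (hH j)] at h
    obtain ⟨t, ht⟩ := h.exists
    exact (ENNReal.ofReal_pos.2 (hpos j t)).ne' ht
  have hR0 : R ≠ 0 := Finset.prod_ne_zero_iff.2 fun j _ => hint_ne j
  have hRtop : R ≠ ⊤ := by
    intro hR
    have := hlow Set.univ MeasurableSet.univ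
    rw [hR, Measure.restrict_univ, ENNReal.mul_top (hint_ne i),
      ENNReal.mul_top (ENNReal.ofReal_pos.2 (Real.exp_pos _)).ne', measure_univ] at this
    exact absurd this (by simp)
  have hle1 : (fun t => ENNReal.ofReal (Real.exp (-B)) * R * H i t) ≤ᵐ[volume] fun _ => 1 := by
    refine ae_le_of_forall_setLIntegral_le_of_sigmaFinite ((hH i).const_mul _) fun S hS _ => ?_
    rw [lintegral_const_mul _ (hH i), setLIntegral_const, one_mul]
    convert hlow S hS using 1
    ring
  have hle2 : (fun _ => 1) ≤ᵐ[volume] fun t => ENNReal.ofReal (Real.exp B) * R * H i t := by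
    refine ae_le_of_forall_setLIntegral_le_of_sigmaFinite measurable_const fun S hS _ => ?_
    rw [lintegral_const_mul _ (hH i), setLIntegral_const, one_mul]
    convert hupp S hS using 1
    ring
  have hr : 0 < R.toReal := ENNReal.toReal_pos hR0 hRtop
  have hconv : ∀ b t, ENNReal.ofReal (Real.exp b) * R * H i t
      = ENNReal.ofReal (Real.exp b * R.toReal * f i t) := fun b t => by
    rw [ENNReal.ofReal_mul (by positivity), ENNReal.ofReal_mul (by positivity),
      ENNReal.ofReal_toReal hRtop]
  refine ⟨B + |Real.log R.toReal|, ?_⟩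
  filter_upwards [hle1, hle2] with t h1 h2
  rw [hconv, ENNReal.ofReal_le_one] at h1
  rw [hconv, ENNReal.one_le_ofReal] at h2
  have h0 := hpos i t
  have h3 := Real.log_nonpos (by positivity) h1
  have h4 := Real.log_nonneg h2
  rw [Real.log_mul (by positivity) h0.ne', Real.log_mul (Real.exp_pos _).ne' hr.ne',
    Real.log_exp] at h3 h4
  rw [abs_le]
  constructor
  · linarith [le_abs_self (Real.log R.toReal)]
  · linarith [neg_abs_le (Real.log R.toReal)]

end ProductForm

/-! ### Densities and entropies of copulas -/

section Copula

open Filter Topology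

variable {d q : ℕ} {φ : Cube d → Fin q → ℝ} {α : Fin q → ℝ} {P : Measure (Cube d)}

instance haveLebesgueDecomposition_cube (P : Measure (Cube d)) [IsFiniteMeasure P] :
    P.HaveLebesgueDecomposition (volume : Measure (Cube d)) :=
  Measure.haveLebesgueDecomposition_of_sigmaFinite P volume

lemma withDensity_pdfOf [IsFiniteMeasure P] (hP : P ≪ volume) :
    volume.withDensity (fun u => ENNReal.ofReal (pdfOf P u)) = P := by
  conv_rhs => rw [← Measure.withDensity_rnDeriv_eq P volume hP]
  refine withDensity_congr_ae ?_
  filter_upwards [Measure.rnDeriv_lt_top P volume] with u hu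
  exact ENNReal.ofReal_toReal hu.ne

lemma pdfOf_withDensity {p : Cube d → ℝ} (hp : AEMeasurable p) (hp0 : ∀ᵐ u, 0 ≤ p u) :
    pdfOf (volume.withDensity fun u => ENNReal.ofReal (p u)) =ᵐ[volume] p := by
  filter_upwards [Measure.rnDeriv_withDensity₀ volume hp.ennreal_ofReal, hp0] with u hu h0
  rw [pdfOf, hu, ENNReal.toReal_ofReal h0]

lemma measurePreserving_eval_of_mem_copulasWithPdf (hP : P ∈ copulasWithPdf d) (i : Fin d) :
    MeasurePreserving (fun u : Cube d => u i) P volume :=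
  ⟨measurable_pi_apply i, hP.2.2 i⟩

lemma isConstrainedDensity_pdfOf (hP : P ∈ feasibleCopulas φ α) :
    IsConstrainedDensity volume (copulaTest φ) (copulaTarget α) (pdfOf P) := by
  have hprob := hP.1.1
  have hac := hP.1.2.1
  refine ⟨(Measure.measurable_rnDeriv P volume).ennreal_toReal, fun u => ENNReal.toReal_nonneg,
    Measure.integrable_toReal_rnDeriv, ?_, fun k => ?_⟩
  · exact (Measure.integral_toReal_rnDeriv hac).trans probReal_univ
  · have h1 : ∫ u, copulaTest φ k u * pdfOf P u = ∫ u, copulaTest φ k u ∂P := by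
      rw [← integral_rnDeriv_smul hac]
      exact integral_congr_ae (Eventually.of_forall fun u => mul_comm _ _)
    rw [h1]
    rcases k with ⟨i, S⟩ | j
    · have hmp := measurePreserving_eval_of_mem_copulasWithPdf hP.1 i
      have h2 := integral_map (μ := P) hmp.measurable.aemeasurable
        (measurable_one.indicator S.2 : Measurable (S.1.indicator (1 : I → ℝ))).aestronglyMeasurable
      rw [hmp.map_eq, integral_indicator_one S.2] at h2
      exact h2.symm
    · exact (hP.2 j).2

lemma withDensity_mem_feasibleCopulas (hmeas : ∀ j, Measurable fun u => φ u j)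
    (hbdd : ∃ C : ℝ, ∀ u j, |φ u j| ≤ C) {p : Cube d → ℝ}
    (hp : IsConstrainedDensity volume (copulaTest φ) (copulaTarget α) p) :
    volume.withDensity (fun u => ENNReal.ofReal (p u)) ∈ feasibleCopulas φ α := by
  have hnn : 0 ≤ᵐ[volume] p := Eventually.of_forall hp.nonneg
  have hprob : IsProbabilityMeasure (volume.withDensity fun u => ENNReal.ofReal (p u)) := by
    refine ⟨?_⟩
    rw [withDensity_apply _ MeasurableSet.univ, Measure.restrict_univ,
      ← ofReal_integral_eq_lintegral_ofReal hp.integrable hnn, hp.integral_eq_one,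
      ENNReal.ofReal_one]
  have hint : ∀ g : Cube d → ℝ, ∫ u, g u ∂(volume.withDensity fun u => ENNReal.ofReal (p u))
      = ∫ u, g u * p u := fun g => by
    rw [integral_withDensity_eq_integral_toReal_smul hp.measurable.ennreal_ofReal
      (Eventually.of_forall fun u => ENNReal.ofReal_lt_top)]
    refine integral_congr_ae (Eventually.of_forall fun u => ?_)
    simp only [ENNReal.toReal_ofReal (hp.nonneg u), smul_eq_mul, mul_comm]
  refine ⟨⟨hprob, withDensity_absolutelyContinuous _ _, fun i => ?_⟩, fun j => ⟨?_, ?_⟩⟩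
  · have := Measure.isProbabilityMeasure_map (μ := volume.withDensity fun u => ENNReal.ofReal (p u))
      (measurable_pi_apply (X := fun _ : Fin d => I) i).aemeasurable
    refine Measure.ext fun S hS => ?_
    rw [← measureReal_eq_measureReal_iff, ← integral_indicator_one hS,
      integral_map (measurable_pi_apply (X := fun _ : Fin d => I) i).aemeasurable
        (measurable_one.indicator hS : Measurable (S.indicator (1 : I → ℝ))).aestronglyMeasurable,
      hint]
    exact hp.integral_mul (.inl (i, ⟨S, hS⟩))
  · obtain ⟨C, hC⟩ := hbdd
    exact Integrable.of_bound (hmeas j).aestronglyMeasurable C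
      (Eventually.of_forall fun u => hC u j)
  · rw [hint]
    exact hp.integral_mul (.inr j)

/-- For a density the term `1 - x` integrates to `0`, so entropy becomes minus the integral of a
nonnegative function. -/
lemma negMulLog_eq_one_sub_sub_klFun (x : ℝ) : Real.negMulLog x = 1 - x - klFun x := by
  simp only [Real.negMulLog, klFun_apply]
  ring

lemma diffEntropy_of_integrable (hP : P ∈ copulasWithPdf d)
    (h : Integrable fun u => klFun (pdfOf P u)) :
    diffEntropy P = ((-∫ u, klFun (pdfOf P u) : ℝ) : EReal) := by
  have hprob := hP.1
  have hpi : Integrable (pdfOf P) := Measure.integrable_toReal_rnDeriv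
  have h1p : Integrable fun u => 1 - pdfOf P u := (integrable_const 1).sub hpi
  have hI : Integrable fun u => Real.negMulLog (pdfOf P u) := by
    simp_rw [negMulLog_eq_one_sub_sub_klFun]
    exact h1p.sub h
  have h1 : ∫ u, Real.negMulLog (pdfOf P u) = -∫ u, klFun (pdfOf P u) := by
    simp_rw [negMulLog_eq_one_sub_sub_klFun]
    have hone : ∫ u, pdfOf P u = 1 :=
      (Measure.integral_toReal_rnDeriv hP.2.1).trans probReal_univ
    rw [integral_sub h1p h, integral_sub (integrable_const 1) hpi, hone]
    simp
  have hfin : ∀ {g : Cube d → ℝ}, Integrable g → ∫⁻ u, ENNReal.ofReal (g u) ≠ ⊤ := fun hg =>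
    hg.lintegral_lt_top.ne
  rw [← h1, integral_eq_lintegral_pos_part_sub_lintegral_neg_part hI, EReal.coe_sub,
    EReal.coe_ennreal_toReal (hfin hI)]
  have hn : Integrable fun u => -Real.negMulLog (pdfOf P u) := hI.neg
  rw [EReal.coe_ennreal_toReal (hfin hn)]
  rfl

/-- As `klFun p ≤ 1 + (p log p)⁺`, the negative part of the entropy must be infinite; in `EReal`,
subtracting `⊤` always gives `⊥`. -/
lemma diffEntropy_of_not_integrable (hP : P ∈ copulasWithPdf d)
    (h : ¬Integrable fun u => klFun (pdfOf P u)) : diffEntropy P = ⊥ := by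
  have hprob := hP.1
  have hpi : Integrable (pdfOf P) := Measure.integrable_toReal_rnDeriv
  have hpm : Measurable (pdfOf P) := (Measure.measurable_rnDeriv P volume).ennreal_toReal
  have htop : ∫⁻ u, ENNReal.ofReal (-Real.negMulLog (pdfOf P u)) = ⊤ := by
    by_contra hne
    refine h ?_
    refine ⟨(measurable_klFun.comp hpm).aestronglyMeasurable, ?_⟩
    have hnn : 0 ≤ᵐ[volume] fun u => klFun (pdfOf P u) :=
      Eventually.of_forall fun u => klFun_nonneg ENNReal.toReal_nonneg
    rw [hasFiniteIntegral_iff_ofReal hnn]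
    calc ∫⁻ u, ENNReal.ofReal (klFun (pdfOf P u))
        ≤ ∫⁻ u, (1 + ENNReal.ofReal (-Real.negMulLog (pdfOf P u))) := by
          refine lintegral_mono fun u => ?_
          rw [← ENNReal.ofReal_one]
          refine le_trans (ENNReal.ofReal_le_ofReal ?_) ENNReal.ofReal_add_le
          have : 0 ≤ pdfOf P u := ENNReal.toReal_nonneg
          rw [negMulLog_eq_one_sub_sub_klFun]
          linarith
      _ = 1 + ∫⁻ u, ENNReal.ofReal (-Real.negMulLog (pdfOf P u)) := by
          rw [lintegral_add_left measurable_const]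
          simp
      _ < ⊤ := ENNReal.add_lt_top.2 ⟨ENNReal.one_lt_top, Ne.lt_top hne⟩
  rw [diffEntropy, htop]
  simp

lemma integrable_klFun_iff_diffEntropy_ne_bot (hP : P ∈ copulasWithPdf d) :
    (Integrable fun u => klFun (pdfOf P u)) ↔ diffEntropy P ≠ ⊥ := by
  refine ⟨fun h => ?_, fun h => ?_⟩
  · rw [diffEntropy_of_integrable hP h]
    exact EReal.coe_ne_bot _
  · by_contra hI
    exact h (diffEntropy_of_not_integrable hP hI)

/-- Pythagorean identity for a feasible copula of exponential form. -/
theorem diffEntropy_sub_eq_klDiv {Q : Measure (Cube d)} (hQ : Q ∈ feasibleCopulas φ α)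
    (hmeas : ∀ j, Measurable fun u => φ u j)
    (hexp : HasExponentialForm φ Q) (hP : P ∈ feasibleCopulas φ α) :
    diffEntropy Q ≠ ⊥ ∧ diffEntropy Q - diffEntropy P = ((klDiv P Q : ENNReal) : EReal) := by
  obtain ⟨θ, f, hf0, hfpos, hflog, hQeq⟩ := hexp
  have hPprob := hP.1.1
  have hQprob := hQ.1.1
  let ρ : Cube d → ℝ := fun u => Real.exp (∑ j, θ j * φ u j) * ∏ i, f i (u i)
  let ℓ : Cube d → ℝ := fun u => ∑ j, θ j * φ u j + ∑ i, Real.log (f i (u i))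
  have hcoord : ∀ᵐ u : Cube d, ∀ i, 0 < f i (u i) := ae_all_iff.2 fun i =>
    (measurePreserving_coord i).quasiMeasurePreserving.ae (hfpos i)
  have hρpos : ∀ᵐ u, 0 < ρ u := by
    filter_upwards [hcoord] with u hu
    exact mul_pos (Real.exp_pos _) (Finset.prod_pos fun i _ => hu i)
  have hρlog : ∀ᵐ u, Real.log (ρ u) = ℓ u := by
    filter_upwards [hcoord] with u hu
    rw [Real.log_mul (Real.exp_pos _).ne' (Finset.prod_pos fun i _ => hu i).ne', Real.log_exp,
      Real.log_prod fun i _ => (hu i).ne']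
  have hlogcoord : ∀ i, AEMeasurable (fun u : Cube d => Real.log (f i (u i))) := fun i =>
    (hflog i).aemeasurable.comp_quasiMeasurePreserving
      (measurePreserving_coord i).quasiMeasurePreserving
  have hℓm : AEMeasurable ℓ := by
    refine AEMeasurable.add ?_ (Finset.aemeasurable_fun_sum _ fun i _ => hlogcoord i)
    exact (Finset.measurable_fun_sum _ fun j _ => (hmeas j).const_mul _).aemeasurable
  have hρm : AEMeasurable ρ := by
    refine (Real.measurable_exp.comp_aemeasurable hℓm).congr ?_
    filter_upwards [hρpos, hρlog] with u h1 h2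
    rw [Function.comp_apply, ← h2, Real.exp_log h1]
  have hpdf : pdfOf Q =ᵐ[volume] ρ := by
    rw [hQeq]
    exact pdfOf_withDensity hρm (hρpos.mono fun u => le_of_lt)
  -- The crux: `ℓ` is built from the moment functions and functions of one coordinate, so its
  -- integral depends only on `α` and the uniform marginals.
  have hℓint : ∀ {Q' : Measure (Cube d)}, Q' ∈ feasibleCopulas φ α → Integrable ℓ Q' ∧
      ∫ u, ℓ u ∂Q' = ∑ j, θ j * α j + ∑ i, ∫ t, Real.log (f i t) := by
    intro Q' hQ'
    have h1 : ∀ i, Integrable (fun u => Real.log (f i (u i))) Q' := fun i =>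
      (measurePreserving_eval_of_mem_copulasWithPdf hQ'.1 i).integrable_comp_of_integrable (hflog i)
    have h2 : ∀ j, Integrable (fun u => θ j * φ u j) Q' := fun j => (hQ'.2 j).1.const_mul _
    have h3 : Integrable (fun u => ∑ j, θ j * φ u j) Q' := integrable_finsetSum _ fun j _ => h2 j
    have h4 : Integrable (fun u => ∑ i, Real.log (f i (u i))) Q' :=
      integrable_finsetSum _ fun i _ => h1 i
    refine ⟨h3.add h4, ?_⟩
    rw [integral_add h3 h4, integral_finsetSum _ fun j _ => h2 j,
      integral_finsetSum _ fun i _ => h1 i]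
    congr 1
    · exact Finset.sum_congr rfl fun j _ => by rw [integral_const_mul, (hQ'.2 j).2]
    · refine Finset.sum_congr rfl fun i _ => ?_
      have hmp := measurePreserving_eval_of_mem_copulasWithPdf hQ'.1 i
      have h5 := integral_map (μ := Q') (f := fun t => Real.log (f i t)) hmp.measurable.aemeasurable
        (by rw [hmp.map_eq]; exact (hflog i).aestronglyMeasurable)
      rw [hmp.map_eq] at h5
      exact h5.symm
  set J := ∑ j, θ j * α j + ∑ i, ∫ t, Real.log (f i t)
  have hlogQ : ∀ᵐ u, Real.log (pdfOf Q u) = ℓ u := by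
    filter_upwards [hpdf, hρlog] with u h1 h2
    rw [h1, h2]
  have hllrQ : llr Q volume =ᵐ[Q] ℓ := hQ.1.2.1.ae_le hlogQ
  have hQi : Integrable (llr Q volume) Q := (hℓint hQ).1.congr hllrQ.symm
  have hklfun : ∀ {Q' : Measure (Cube d)}, Q' ∈ copulasWithPdf d → Integrable (llr Q' volume) Q' →
      diffEntropy Q' = ((-∫ u, llr Q' volume u ∂Q' : ℝ) : EReal) := by
    intro Q' hQ' hi
    have := hQ'.1
    rw [diffEntropy_of_integrable hQ' ((integrable_klFun_rnDeriv_iff hQ'.2.1).2 hi)]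
    have h := integral_klFun_rnDeriv hQ'.2.1 hi
    simp only [probReal_univ, add_sub_cancel_right] at h
    rw [← h]
    rfl
  have hQent : diffEntropy Q = ((-J : ℝ) : EReal) := by
    rw [hklfun hQ.1 hQi, integral_congr_ae hllrQ, (hℓint hQ).2]
  refine ⟨hQent ▸ EReal.coe_ne_bot _, ?_⟩
  have hvolQ : volume ≪ Q := by
    rw [hQeq]
    refine withDensity_absolutelyContinuous' hρm.ennreal_ofReal ?_
    filter_upwards [hρpos] with u hu
    exact (ENNReal.ofReal_pos.2 hu).ne'
  have hPQ : P ≪ Q := hP.1.2.1.trans hvolQ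
  have hllr : llr P Q =ᵐ[P] fun u => llr P volume u - ℓ u := by
    filter_upwards [hP.1.2.1.ae_le (Measure.rnDeriv_mul_rnDeriv (κ := volume) hPQ),
      Measure.rnDeriv_pos hP.1.2.1, hP.1.2.1.ae_le (Measure.rnDeriv_lt_top P volume),
      hP.1.2.1.ae_le hlogQ] with u h1 h2 h3 h4
    have h5 : (P.rnDeriv Q u).toReal * (Q.rnDeriv volume u).toReal
        = (P.rnDeriv volume u).toReal := by
      rw [← ENNReal.toReal_mul, ← h1, Pi.mul_apply]
    have h6 : 0 < (P.rnDeriv volume u).toReal := ENNReal.toReal_pos h2.ne' h3.ne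
    rw [← h5] at h6
    have h7 := left_ne_zero_of_mul h6.ne'
    have h8 := right_ne_zero_of_mul h6.ne'
    rw [← h4]
    simp only [llr, pdfOf]
    rw [← h5, Real.log_mul h7 h8]
    ring
  have hℓP := (hℓint hP).1
  by_cases hPi : Integrable (llr P volume) P
  · have hPQi : Integrable (llr P Q) P := (hPi.sub hℓP).congr hllr.symm
    have hval : ∫ u, llr P Q u ∂P = ∫ u, llr P volume u ∂P - J := by
      rw [integral_congr_ae hllr, integral_sub hPi hℓP, (hℓint hP).2]
    have hnn := integral_llr_add_sub_measure_univ_nonneg hPQ hPQi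
    rw [klDiv_of_ac_of_integrable hPQ hPQi, EReal.coe_ennreal_ofReal, max_eq_left hnn, hQent,
      hklfun hP.1 hPi, ← EReal.coe_sub, hval]
    simp only [probReal_univ]
    congr 1
    ring
  -- Since `ℓ` is `P`-integrable, infinite entropy of `P` makes both sides of the identity `⊤`.
  · have hPQi : ¬Integrable (llr P Q) P := fun h => hPi <| by
      refine (h.add hℓP).congr ?_
      filter_upwards [hllr] with u hu
      rw [Pi.add_apply, hu]
      ring
    rw [klDiv_of_not_integrable hPQi, diffEntropy_of_not_integrable hP.1
      fun h => hPi ((integrable_klFun_rnDeriv_iff hP.1.2.1).1 h), hQent]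
    rfl

end Copula

/-! ### The maximum entropy copula -/

section MaxEntropy

open Filter Topology

variable {d q : ℕ} {φ : Cube d → Fin q → ℝ} {α : Fin q → ℝ} {P : Measure (Cube d)}

lemma diffEntropy_withDensity (hmeas : ∀ j, Measurable fun u => φ u j)
    (hbdd : ∃ C : ℝ, ∀ u j, |φ u j| ≤ C) {p : Cube d → ℝ}
    (hp : IsConstrainedDensity volume (copulaTest φ) (copulaTarget α) p)
    (hF : Integrable fun u => klFun (p u)) :
    diffEntropy (volume.withDensity fun u => ENNReal.ofReal (p u))
      = ((-∫ u, klFun (p u) : ℝ) : EReal) := by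
  have hpdf := pdfOf_withDensity hp.measurable.aemeasurable (Eventually.of_forall hp.nonneg)
  have hkl := hpdf.fun_comp klFun
  rw [diffEntropy_of_integrable (withDensity_mem_feasibleCopulas hmeas hbdd hp).1
    (hF.congr hkl.symm)]
  exact congrArg (fun r : ℝ => ((-r : ℝ) : EReal)) (integral_congr_ae hkl)

/-- The feasible copula of finite entropy rules out a maximum equal to `-∞`, at which every feasible
copula would be a maximizer. -/
lemma IsMaxEntropyCopula.isEntropyMinimizer (hmeas : ∀ j, Measurable fun u => φ u j)
    (hbdd : ∃ C : ℝ, ∀ u j, |φ u j| ≤ C)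
    (hfeas : ∃ P ∈ feasibleCopulas φ α, HasFiniteEntropy P) (hP : IsMaxEntropyCopula φ α P) :
    IsEntropyMinimizer volume (copulaTest φ) (copulaTarget α) (pdfOf P) := by
  obtain ⟨P₀, hP₀, hfin⟩ := hfeas
  have hle : diffEntropy P₀ ≤ diffEntropy P := hP.2 hP₀
  have hI : Integrable fun u => klFun (pdfOf P u) :=
    (integrable_klFun_iff_diffEntropy_ne_bot hP.1.1).2 fun h => hfin.1 (le_bot_iff.1 (h ▸ hle))
  refine ⟨isConstrainedDensity_pdfOf hP.1, hI, fun p' hp' hI' => ?_⟩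
  have hle' : diffEntropy (volume.withDensity fun u => ENNReal.ofReal (p' u)) ≤ diffEntropy P :=
    hP.2 (withDensity_mem_feasibleCopulas hmeas hbdd hp')
  rw [diffEntropy_withDensity hmeas hbdd hp' hI', diffEntropy_of_integrable hP.1.1 hI,
    EReal.coe_le_coe_iff] at hle'
  linarith

lemma IsEntropyMinimizer.isMaxEntropyCopula (hmeas : ∀ j, Measurable fun u => φ u j)
    (hbdd : ∃ C : ℝ, ∀ u j, |φ u j| ≤ C) {p : Cube d → ℝ}
    (hp : IsEntropyMinimizer volume (copulaTest φ) (copulaTarget α) p) :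
    IsMaxEntropyCopula φ α (volume.withDensity fun u => ENNReal.ofReal (p u)) := by
  refine ⟨withDensity_mem_feasibleCopulas hmeas hbdd hp.density, fun P hP => ?_⟩
  change diffEntropy P ≤ diffEntropy _
  rw [diffEntropy_withDensity hmeas hbdd hp.density hp.integrable]
  by_cases hI : Integrable fun u => klFun (pdfOf P u)
  · rw [diffEntropy_of_integrable hP.1 hI, EReal.coe_le_coe_iff]
    exact neg_le_neg (hp.le _ (isConstrainedDensity_pdfOf hP) hI)
  · rw [diffEntropy_of_not_integrable hP.1 hI]
    exact bot_le

lemma IsMaxEntropyCopula.unique (hmeas : ∀ j, Measurable fun u => φ u j)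
    (hbdd : ∃ C : ℝ, ∀ u j, |φ u j| ≤ C)
    (hfeas : ∃ P ∈ feasibleCopulas φ α, HasFiniteEntropy P) {Q : Measure (Cube d)}
    (hP : IsMaxEntropyCopula φ α P) (hQ : IsMaxEntropyCopula φ α Q) : P = Q := by
  have hae := (hP.isEntropyMinimizer hmeas hbdd hfeas).ae_eq (boundedTests_copulaTest hmeas hbdd)
    (hQ.isEntropyMinimizer hmeas hbdd hfeas)
  have := hP.1.1.1
  have := hQ.1.1.1
  rw [← withDensity_pdfOf hP.1.1.2.1, ← withDensity_pdfOf hQ.1.1.2.1]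
  exact withDensity_congr_ae (hae.fun_comp ENNReal.ofReal)

lemma HasExponentialForm.isMaxEntropyCopula (hmeas : ∀ j, Measurable fun u => φ u j)
    (hP : P ∈ feasibleCopulas φ α) (hexp : HasExponentialForm φ P) :
    IsMaxEntropyCopula φ α P := by
  refine ⟨hP, fun P' hP' => ?_⟩
  obtain ⟨hbot, hsub⟩ := diffEntropy_sub_eq_klDiv hP hmeas hexp hP'
  rw [← integrable_klFun_iff_diffEntropy_ne_bot hP.1] at hbot
  have h0 : 0 ≤ diffEntropy P - diffEntropy P' := hsub ▸ EReal.coe_ennreal_nonneg _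
  change diffEntropy P' ≤ diffEntropy P
  by_cases hI : Integrable fun u => klFun (pdfOf P' u)
  · rw [diffEntropy_of_integrable hP.1 hbot, diffEntropy_of_integrable hP'.1 hI] at h0 ⊢
    rw [← EReal.coe_sub, EReal.coe_nonneg] at h0
    rw [EReal.coe_le_coe_iff]
    linarith
  · rw [diffEntropy_of_not_integrable hP'.1 hI]
    exact bot_le

/-- The variational argument gives positive measurable factors; integrability of their logarithms
follows from `exists_abs_log_factor_le`, as `∑ θ j φ j` is bounded and the marginals are uniform. -/
lemma IsEntropyMinimizer.hasExponentialForm [NeZero q]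
    (hmeas : ∀ j, Measurable fun u => φ u j) (hbdd : ∃ C : ℝ, ∀ u j, |φ u j| ≤ C)
    (hP1 : ∀ u, φ u 0 = 1) {p : Cube d → ℝ}
    (hp : IsEntropyMinimizer volume (copulaTest φ) (copulaTarget α) p)
    (hpos : ∀ᵐ u, 0 < p u) :
    HasExponentialForm φ (volume.withDensity fun u => ENNReal.ofReal (p u)) := by
  obtain ⟨θ, f, hfm, hfpos, hpf⟩ := hp.exists_exponential_form hmeas hbdd hP1 hpos
  have hfeas := withDensity_mem_feasibleCopulas hmeas hbdd hp.density
  have heq : volume.withDensity (fun u => ENNReal.ofReal (p u)) = volume.withDensity fun u =>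
      ENNReal.ofReal (Real.exp (∑ j, θ j * φ u j) * ∏ i, f i (u i)) :=
    withDensity_congr_ae (hpf.fun_comp ENNReal.ofReal)
  rw [heq] at hfeas ⊢
  obtain ⟨C, hC⟩ := hbdd
  have hE : ∀ u, |∑ j, θ j * φ u j| ≤ ∑ j, |θ j| * C := fun u =>
    (Finset.abs_sum_le_sum_abs _ _).trans (Finset.sum_le_sum fun j _ => by
      rw [abs_mul]
      exact mul_le_mul_of_nonneg_left (hC u j) (abs_nonneg _))
  refine ⟨θ, f, fun i t => (hfpos i t).le, fun i => Eventually.of_forall (hfpos i),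
    fun i => ?_, rfl⟩
  obtain ⟨M, hM⟩ := exists_abs_log_factor_le hE hfm hfpos hfeas.1.2.2 i
  exact Integrable.of_bound (Real.measurable_log.comp (hfm i)).aestronglyMeasurable M hM

end MaxEntropy

theorem mainTheorem1 {d q : ℕ} [NeZero q] (φ : Cube d → Fin q → ℝ) (α : Fin q → ℝ)
    (hmeas : ∀ j, Measurable (fun u => φ u j))
    (hbdd : ∃ C : ℝ, ∀ u j, |φ u j| ≤ C)
    (hP1 : ∀ u, φ u 0 = 1)
    (hfeas : ∃ P ∈ feasibleCopulas φ α, HasFiniteEntropy P) :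
    ∃ PM : Measure (Cube d),
      -- the problem has exactly one solution
      IsMaxEntropyCopula φ α PM ∧
      (∀ P, IsMaxEntropyCopula φ α P → P = PM) ∧
      -- no other feasible copula has a density of the exponential form
      (∀ P ∈ feasibleCopulas φ α, HasExponentialForm φ P → P = PM) ∧
      -- exponential form and Pythagorean identity, when the constraint does not force the
      -- density to vanish on a set of positive measure
      ((∃ P ∈ feasibleCopulas φ α, HasFiniteEntropy P ∧ ∀ᵐ u : Cube d, 0 < pdfOf P u) →
        HasExponentialForm φ PM ∧
        ∀ P ∈ feasibleCopulas φ α,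
          diffEntropy PM - diffEntropy P = ((klDiv P PM : ENNReal) : EReal)) := by
  have hψ := boundedTests_copulaTest hmeas hbdd
  obtain ⟨P₀, hP₀, hfin⟩ := hfeas
  obtain ⟨p, hp⟩ := exists_isEntropyMinimizer hψ (isConstrainedDensity_pdfOf hP₀)
    ((integrable_klFun_iff_diffEntropy_ne_bot hP₀.1).2 hfin.1)
  have hmax := hp.isMaxEntropyCopula hmeas hbdd
  have huniq := fun P (hP : IsMaxEntropyCopula φ α P) =>
    hP.unique hmeas hbdd ⟨P₀, hP₀, hfin⟩ hmax
  refine ⟨_, hmax, huniq, fun P hP hexp => huniq P (hexp.isMaxEntropyCopula hmeas hP), ?_⟩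
  rintro ⟨P₁, hP₁, hfin₁, hpos₁⟩
  have hpos := hp.ae_pos hψ (isConstrainedDensity_pdfOf hP₁)
    ((integrable_klFun_iff_diffEntropy_ne_bot hP₁.1).2 hfin₁.1) hpos₁
  have hexp := hp.hasExponentialForm hmeas hbdd hP1 hpos
  exact ⟨hexp, fun P hP => (diffEntropy_sub_eq_klDiv hmax.1 hmeas hexp hP).2⟩
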